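/- Monadic second-order logic with the unbounding quantifier, MSO+U, over the structure $(\mathbb N,\le)$ has first-order variables ranging over natural numbers, set variables ranging over arbitrary subsets of $\mathbb N$, atomic formulas $x\le y$, $x=y$, $x\in X$, the Boolean connectives, quantification over both kinds of variables, and the quantifier $\mathsf U X.\,\varphi(X)$, which says that $\varphi(X)$ holds for arbitrarily large finite sets, i.e. for every $n\in\mathbb N$ there is a finite set $X\subseteq\mathbb N$ with at least $n$ elements that satisfies $\varphi(X)$ (here $\varphi$ may have other free variables besides $X$). **Theorem 1.** The MSO+U theory of $(\mathbb N,\le)$ is undecidable: there is no algorithm which, given a sentence of MSO+U, decides whether it is true in $(\mathbb N,\le)$. Equivalently, satisfiability of MSO+U over infinite words is undecidable: for every nonempty finite alphabet $A$ there is no algorithm which, given a sentence of MSO+U that may additionally use the atomic formulas "position $x$ carries the letter $a$" for $a\in A$, decides whether it is satisfied by some infinite word $w\in A^\omega$. -/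

import Mathlib

namespace MSOU

/-- Formulas of MSO+U over the order `(ℕ, ≤)`, with one additional unary predicate symbol for each
element of `A`. The plain logic over `(ℕ, ≤)` is the case `A = Empty`; the logic over infinite
words with alphabet `A` has a predicate "position `x` carries the letter `a`" for each `a : A`.
First-order variables (positions) and set variables are two separate families, each indexed by `ℕ`.
The other connectives and the universal quantifiers are the usual abbreviations. -/
inductive Formula (A : Type) : Type where
  /-- `x ≤ y` -/
  | le (x y : ℕ)
  /-- `x = y` -/
  | eq (x y : ℕ)
  /-- `x ∈ X` -/
  | mem (x X : ℕ)
  /-- position `x` carries the letter `a` -/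
  | letter (a : A) (x : ℕ)
  /-- `¬ φ` -/
  | not (φ : Formula A)
  /-- `φ ∧ ψ` -/
  | and (φ ψ : Formula A)
  /-- `∃ x, φ`, with `x` a first-order variable -/
  | exPos (x : ℕ) (φ : Formula A)
  /-- `∃ X, φ`, with `X` a set variable, ranging over all (finite or infinite) sets -/
  | exSet (X : ℕ) (φ : Formula A)
  /-- `U X. φ`, the unbounding quantifier -/
  | unbounding (X : ℕ) (φ : Formula A)

namespace Formula

variable {A : Type}

/-- `φ.Sat P v V` is satisfaction of `φ` in the structure with domain `ℕ`, its usual order, and `P a` as the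
set of positions which carry the letter `a`; the first-order variable `x` is interpreted as `v x`,
and the set variable `X` as `V X`. -/
def Sat (P : A → Set ℕ) : Formula A → (ℕ → ℕ) → (ℕ → Set ℕ) → Prop
  | le x y, v, _ => v x ≤ v y
  | eq x y, v, _ => v x = v y
  | mem x X, v, V => v x ∈ V X
  | letter a x, v, _ => v x ∈ P a
  | not φ, v, V => ¬ Sat P φ v V
  | and φ ψ, v, V => Sat P φ v V ∧ Sat P ψ v V
  | exPos x φ, v, V => ∃ n : ℕ, Sat P φ (Function.update v x n) V
  | exSet X φ, v, V => ∃ S : Set ℕ, Sat P φ v (Function.update V X S)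
  | unbounding X φ, v, V =>
      ∀ n : ℕ, ∃ S : Finset ℕ, n ≤ S.card ∧ Sat P φ v (Function.update V X (S : Set ℕ))

/-- The first-order variables with a free occurrence. -/
def freePos : Formula A → Finset ℕ
  | le x y => {x, y}
  | eq x y => {x, y}
  | mem x _ => {x}
  | letter _ x => {x}
  | not φ => freePos φ
  | and φ ψ => freePos φ ∪ freePos ψ
  | exPos x φ => (freePos φ).erase x
  | exSet _ φ => freePos φ
  | unbounding _ φ => freePos φ

/-- The set variables with a free occurrence. -/
def freeSet : Formula A → Finset ℕ
  | le _ _ => ∅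
  | eq _ _ => ∅
  | mem _ X => {X}
  | letter _ _ => ∅
  | not φ => freeSet φ
  | and φ ψ => freeSet φ ∪ freeSet ψ
  | exPos _ φ => freeSet φ
  | exSet X φ => (freeSet φ).erase X
  | unbounding X φ => (freeSet φ).erase X

/-- A sentence is a formula without free variables. -/
def IsSentence (φ : Formula A) : Prop := φ.freePos = ∅ ∧ φ.freeSet = ∅

/-- Gödel numbering: a formula is written as the number of its outermost constructor, paired with
the codes of the arguments. -/
def code [Encodable A] : Formula A → ℕ
  | le x y => Nat.pair 0 (Nat.pair x y)
  | eq x y => Nat.pair 1 (Nat.pair x y)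
  | mem x X => Nat.pair 2 (Nat.pair x X)
  | letter a x => Nat.pair 3 (Nat.pair (Encodable.encode a) x)
  | not φ => Nat.pair 4 (code φ)
  | and φ ψ => Nat.pair 5 (Nat.pair (code φ) (code ψ))
  | exPos x φ => Nat.pair 6 (Nat.pair x (code φ))
  | exSet X φ => Nat.pair 7 (Nat.pair X (code φ))
  | unbounding X φ => Nat.pair 8 (Nat.pair X (code φ))

theorem code_injective [Encodable A] : Function.Injective (code : Formula A → ℕ) := by
  intro φ
  induction φ with
  | not φ ih =>
    intro ψ h
    cases ψ <;> simp only [code, Nat.pair_eq_pair] at h <;> try omega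
    rw [ih h.2]
  | and φ ψ ih ih2 =>
    intro χ h
    cases χ <;> simp only [code, Nat.pair_eq_pair] at h <;> try omega
    rw [ih h.2.1, ih2 h.2.2]
  | exPos x φ ih | exSet x φ ih | unbounding x φ ih =>
    intro ψ h
    cases ψ <;> simp only [code, Nat.pair_eq_pair] at h <;> try omega
    rw [h.2.1, ih h.2.2]
  | _ =>
    intro ψ h
    cases ψ <;> simp_all [code, Nat.pair_eq_pair]

end Formula

/-- A set of formulas is decidable if some algorithm, given a natural number, decides whether it is
the code of a formula in the set. -/
def IsDecidable {A : Type} [Encodable A] (T : Set (Formula A)) : Prop :=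
  ComputablePred fun n : ℕ => ∃ φ ∈ T, φ.code = n

/-- The MSO+U theory of `(ℕ, ≤)`: the set of all sentences which are true in this structure. -/
def theoryNatLE : Set (Formula Empty) :=
  {φ | φ.IsSentence ∧ ∀ v V, φ.Sat (fun a => a.elim) v V}

/-- The infinite word `w` satisfies `φ` (for all values of the variables, which matter only if
`φ` is not a sentence). -/
def WordSatisfies {A : Type} (w : ℕ → A) (φ : Formula A) : Prop :=
  ∀ v V, φ.Sat (fun a => {i | w i = a}) v V

/-- The sentences of MSO+U which are satisfied by some infinite word over the alphabet `A`. -/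
def satisfiableOverWords (A : Type) : Set (Formula A) :=
  {φ | φ.IsSentence ∧ ∃ w : ℕ → A, WordSatisfies w φ}

end MSOU

/-! Two sets B and C cut ℕ into blocks and the blocks into cells, with cell lengths and numbers of
cells per block tending to infinity. A set F stores a number at each cell start, the size of its
restriction to the cell. The elements of X ⊆ C in the successive blocks thus index a sequence of
vectors, and the quantifier `U` tells along which sets of cells the stored numbers are bounded.

This is enough to compare dimensions. `Dominated` says that, whatever is stored on X, something can
be stored on X' such that every choice of at most one coordinate per block of X is matched by such a
choice on X', one block later, with the same bounded subsequences. An injection from each block of X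
into the next block of X' provides this by copying (`dominated_of_eventually_le`). Conversely,
suppose that infinitely often d elements of X face fewer than d elements of X'. Store all vectors of
ℕ^d on such blocks. In a vector with rapidly growing coordinates every coordinate has a partner, so
two of them share one; then the larger is bounded in terms of the smaller, which fast enough growth
excludes (`eventually_le_of_dominated`).

Hence a set X with boundedly many elements per block dominates itself exactly if its count per block
is eventually constant, and that constant is the number which X represents (`isNum_iff`). Disjoint
unions give addition and rows of equal size give multiplication (`addRel_iff`, `mulRel_iff`), so
partial recursive functions become definable (`arithDef_of_partrec`). The partition is quantified
existentially, and `exists_good` supplies one. Halting of the k-th program becomes a sentence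
without letters, computable from k, which settles the theory of (ℕ, ≤) and satisfiability over words
at once. -/

namespace MSOU

/-! ### Closure properties of MSO+U definability -/

open Set Function

/-- A context: a type of environments, presented by finitely many coordinates that are positions and
finitely many coordinates that are sets of positions. -/
class Ctx (Γ : Type) where
  P : Type
  S : Type
  finP : Finite P
  finS : Finite S
  pos : P → Γ → ℕ
  set : S → Γ → Set ℕ

instance : Ctx Unit where
  P := Empty
  S := Empty
  finP := inferInstance
  finS := inferInstance
  pos i := i.elim
  set i := i.elim

variable {Γ Δ : Type} [Ctx Γ] [Ctx Δ]

instance : Finite (Ctx.P Γ) := Ctx.finP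
instance : Finite (Ctx.S Γ) := Ctx.finS

instance : Ctx (Γ × ℕ) where
  P := Option (Ctx.P Γ)
  S := Ctx.S Γ
  finP := inferInstance
  finS := inferInstance
  pos i p := i.elim p.2 fun j => Ctx.pos j p.1
  set j p := Ctx.set j p.1

instance : Ctx (Γ × Set ℕ) where
  P := Ctx.P Γ
  S := Option (Ctx.S Γ)
  finP := inferInstance
  finS := inferInstance
  pos i p := Ctx.pos i p.1
  set j p := j.elim p.2 fun k => Ctx.set k p.1

/-- Definability in MSO+U, without letters: however the coordinates of the context are named by
variables, some formula whose free variables are among these names defines `Q`. -/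
def Definable (Q : Γ → Prop) : Prop :=
  ∀ (A : Type) (α : Ctx.P Γ → ℕ) (β : Ctx.S Γ → ℕ), ∃ φ : Formula A,
    (∀ n ∈ φ.freePos, n ∈ range α) ∧ (∀ n ∈ φ.freeSet, n ∈ range β) ∧
    ∀ P v V γ, (∀ i, v (α i) = Ctx.pos i γ) → (∀ j, V (β j) = Ctx.set j γ) → (φ.Sat P v V ↔ Q γ)

theorem exists_fresh {ι : Type} [Finite ι] (f : ι → ℕ) : ∃ n, ∀ i, f i ≠ n := by
  obtain ⟨n, hn⟩ := (finite_range f).infinite_compl.nonempty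
  exact ⟨n, fun i h => hn ⟨i, h⟩⟩

namespace Definable

/-- The formula for Q serves unchanged once its variables are named by the coordinates of Δ they
come from. This is why definability is required for all namings, including non-injective ones. -/
theorem comp {Q : Γ → Prop} (hQ : Definable Q) (h : Δ → Γ)
    (hp : ∀ i : Ctx.P Γ, ∃ j : Ctx.P Δ, ∀ δ, Ctx.pos j δ = Ctx.pos i (h δ))
    (hs : ∀ i : Ctx.S Γ, ∃ j : Ctx.S Δ, ∀ δ, Ctx.set j δ = Ctx.set i (h δ)) :
    Definable fun δ => Q (h δ) := by
  choose f hf using hp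
  choose g hg using hs
  intro A α β
  obtain ⟨φ, h1, h2, h3⟩ := hQ A (α ∘ f) (β ∘ g)
  refine ⟨φ, fun n hn => range_comp_subset_range _ _ (h1 n hn),
    fun n hn => range_comp_subset_range _ _ (h2 n hn), fun P v V δ hv hV => ?_⟩
  exact h3 P v V (h δ) (fun i => by simp [hv, hf]) (fun i => by simp [hV, hg])

theorem not {Q : Γ → Prop} (hQ : Definable Q) : Definable fun γ => ¬ Q γ := by
  intro A α β
  obtain ⟨φ, h1, h2, h3⟩ := hQ A α β
  exact ⟨.not φ, h1, h2, fun P v V γ hv hV => not_congr (h3 P v V γ hv hV)⟩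

theorem and {Q R : Γ → Prop} (hQ : Definable Q) (hR : Definable R) :
    Definable fun γ => Q γ ∧ R γ := by
  intro A α β
  obtain ⟨φ, h1, h2, h3⟩ := hQ A α β
  obtain ⟨ψ, k1, k2, k3⟩ := hR A α β
  refine ⟨.and φ ψ, fun n hn => ?_, fun n hn => ?_, fun P v V γ hv hV =>
    and_congr (h3 P v V γ hv hV) (k3 P v V γ hv hV)⟩
  · exact (Finset.mem_union.1 hn).elim (h1 n) (k1 n)
  · exact (Finset.mem_union.1 hn).elim (h2 n) (k2 n)

theorem imp {Q R : Γ → Prop} (hQ : Definable Q) (hR : Definable R) :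
    Definable fun γ => Q γ → R γ := by
  simpa only [not_and, not_not] using (hQ.and hR.not).not

theorem or {Q R : Γ → Prop} (hQ : Definable Q) (hR : Definable R) :
    Definable fun γ => Q γ ∨ R γ := by
  simpa only [or_iff_not_imp_left] using hQ.not.imp hR

theorem iff {Q R : Γ → Prop} (hQ : Definable Q) (hR : Definable R) :
    Definable fun γ => Q γ ↔ R γ := by
  simpa only [iff_iff_implies_and_implies] using (hQ.imp hR).and (hR.imp hQ)

/-- The bound variable must avoid the names in use; a fresh one exists because contexts have
finitely many coordinates. -/
theorem exPos {Q : Γ → ℕ → Prop} (hQ : Definable fun p : Γ × ℕ => Q p.1 p.2) :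
    Definable fun γ => ∃ n, Q γ n := by
  intro A α β
  obtain ⟨x, hx⟩ := exists_fresh α
  obtain ⟨φ, h1, h2, h3⟩ := hQ A (fun i : Option _ => i.elim x α) β
  refine ⟨.exPos x φ, fun n hn => ?_, h2, fun P v V γ hv hV => exists_congr fun n =>
    h3 P _ V (γ, n) ?_ hV⟩
  · obtain ⟨hne, hn⟩ := Finset.mem_erase.1 hn
    obtain ⟨_ | i, rfl⟩ := h1 n hn
    · exact absurd rfl hne
    · exact ⟨i, rfl⟩
  · rintro (_ | i)
    · simp [Ctx.pos]
    · simp [Ctx.pos, update_of_ne (hx i), hv]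

theorem exSet {Q : Γ → Set ℕ → Prop} (hQ : Definable fun p : Γ × Set ℕ => Q p.1 p.2) :
    Definable fun γ => ∃ S, Q γ S := by
  intro A α β
  obtain ⟨X, hX⟩ := exists_fresh β
  obtain ⟨φ, h1, h2, h3⟩ := hQ A α (fun i : Option _ => i.elim X β)
  refine ⟨.exSet X φ, h1, fun n hn => ?_, fun P v V γ hv hV => exists_congr fun S =>
    h3 P v _ (γ, S) hv ?_⟩
  · obtain ⟨hne, hn⟩ := Finset.mem_erase.1 hn
    obtain ⟨_ | i, rfl⟩ := h2 n hn
    · exact absurd rfl hne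
    · exact ⟨i, rfl⟩
  · rintro (_ | i)
    · simp [Ctx.set]
    · simp [Ctx.set, update_of_ne (hX i), hV]

theorem unbounding {Q : Γ → Set ℕ → Prop} (hQ : Definable fun p : Γ × Set ℕ => Q p.1 p.2) :
    Definable fun γ => ∀ n : ℕ, ∃ S : Finset ℕ, n ≤ S.card ∧ Q γ S := by
  intro A α β
  obtain ⟨X, hX⟩ := exists_fresh β
  obtain ⟨φ, h1, h2, h3⟩ := hQ A α (fun i : Option _ => i.elim X β)
  refine ⟨.unbounding X φ, h1, fun n hn => ?_, fun P v V γ hv hV => forall_congr' fun n =>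
    exists_congr fun S => and_congr_right fun _ => h3 P v _ (γ, S) hv ?_⟩
  · obtain ⟨hne, hn⟩ := Finset.mem_erase.1 hn
    obtain ⟨_ | i, rfl⟩ := h2 n hn
    · exact absurd rfl hne
    · exact ⟨i, rfl⟩
  · rintro (_ | i)
    · simp [Ctx.set]
    · simp [Ctx.set, update_of_ne (hX i), hV]

theorem allPos {Q : Γ → ℕ → Prop} (hQ : Definable fun p : Γ × ℕ => Q p.1 p.2) :
    Definable fun γ => ∀ n, Q γ n := by
  simpa only [not_exists, not_not] using (exPos (Q := fun γ n => ¬ Q γ n) hQ.not).not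

theorem allSet {Q : Γ → Set ℕ → Prop} (hQ : Definable fun p : Γ × Set ℕ => Q p.1 p.2) :
    Definable fun γ => ∀ S, Q γ S := by
  simpa only [not_exists, not_not] using (exSet (Q := fun γ n => ¬ Q γ n) hQ.not).not

end Definable

/-- A position-valued term, given by its definable graph. -/
def DefPos (x : Γ → ℕ) : Prop := Definable fun p : Γ × ℕ => x p.1 = p.2

/-- A set-valued term, given by its definable membership relation. -/
def DefSet (X : Γ → Set ℕ) : Prop := Definable fun p : Γ × ℕ => p.2 ∈ X p.1

theorem DefPos.snd : DefPos fun p : Γ × ℕ => p.2 := fun _ α _ =>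
  ⟨.eq (α (some none)) (α none), by simp [Formula.freePos], by simp [Formula.freeSet],
    fun P v V γ hv hV => by simp [Formula.Sat, hv, Ctx.pos]⟩

theorem DefSet.snd : DefSet fun p : Γ × Set ℕ => p.2 := fun _ α β =>
  ⟨.mem (α none) (β none), by simp [Formula.freePos], by simp [Formula.freeSet],
    fun P v V γ hv hV => by simp [Formula.Sat, hv, hV, Ctx.pos, Ctx.set]⟩

/-- Weakening: a term stays definable when the context grows by a position (`wkN`) or by a set
(`wkS`). The coordinate `none` is always the newest one. -/
theorem DefPos.wkN {x : Γ → ℕ} (hx : DefPos x) : DefPos fun p : Γ × ℕ => x p.1 :=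
  hx.comp (fun p : (Γ × ℕ) × ℕ => (p.1.1, p.2))
    (by rintro (_ | i); exacts [⟨none, fun _ => rfl⟩, ⟨some (some i), fun _ => rfl⟩])
    (fun i => ⟨i, fun _ => rfl⟩)

theorem DefPos.wkS {x : Γ → ℕ} (hx : DefPos x) : DefPos fun p : Γ × Set ℕ => x p.1 :=
  hx.comp (fun p : (Γ × Set ℕ) × ℕ => (p.1.1, p.2))
    (by rintro (_ | i); exacts [⟨none, fun _ => rfl⟩, ⟨some i, fun _ => rfl⟩])
    (fun i => ⟨some i, fun _ => rfl⟩)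

theorem DefSet.wkN {X : Γ → Set ℕ} (hX : DefSet X) : DefSet fun p : Γ × ℕ => X p.1 :=
  hX.comp (fun p : (Γ × ℕ) × ℕ => (p.1.1, p.2))
    (by rintro (_ | i); exacts [⟨none, fun _ => rfl⟩, ⟨some (some i), fun _ => rfl⟩])
    (fun i => ⟨i, fun _ => rfl⟩)

theorem DefSet.wkS {X : Γ → Set ℕ} (hX : DefSet X) : DefSet fun p : Γ × Set ℕ => X p.1 :=
  hX.comp (fun p : (Γ × Set ℕ) × ℕ => (p.1.1, p.2))
    (by rintro (_ | i); exacts [⟨none, fun _ => rfl⟩, ⟨some i, fun _ => rfl⟩])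
    (fun i => ⟨some i, fun _ => rfl⟩)

theorem DefPos.eq {x y : Γ → ℕ} (hx : DefPos x) (hy : DefPos y) : Definable fun γ => x γ = y γ := by
  simpa [eq_comm] using Definable.exPos (Q := fun γ n => x γ = n ∧ y γ = n) (Definable.and hx hy)

theorem DefPos.le {x y : Γ → ℕ} (hx : DefPos x) (hy : DefPos y) : Definable fun γ => x γ ≤ y γ := by
  have h : Definable fun p : (Γ × ℕ) × ℕ => p.1.2 ≤ p.2 := fun _ α _ =>
    ⟨.le (α (some none)) (α none), by simp [Formula.freePos], by simp [Formula.freeSet],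
      fun P v V γ hv hV => by simp [Formula.Sat, hv, Ctx.pos]⟩
  have := Definable.exPos (Q := fun γ m => ∃ n, (x γ = m ∧ y γ = n) ∧ m ≤ n)
    (Definable.exPos (((hx.wkN.wkN.eq DefPos.snd.wkN).and (hy.wkN.wkN.eq DefPos.snd)).and h))
  simpa using this

theorem DefPos.lt {x y : Γ → ℕ} (hx : DefPos x) (hy : DefPos y) : Definable fun γ => x γ < y γ := by
  simpa only [not_le] using (hy.le hx).not

theorem DefPos.ne {x y : Γ → ℕ} (hx : DefPos x) (hy : DefPos y) : Definable fun γ => x γ ≠ y γ :=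
  (hx.eq hy).not

theorem DefPos.mem {x : Γ → ℕ} {X : Γ → Set ℕ} (hx : DefPos x) (hX : DefSet X) :
    Definable fun γ => x γ ∈ X γ := by
  simpa using Definable.exPos (Q := fun γ n => x γ = n ∧ n ∈ X γ) (Definable.and hx hX)

theorem DefSet.subset {X Y : Γ → Set ℕ} (hX : DefSet X) (hY : DefSet Y) :
    Definable fun γ => X γ ⊆ Y γ :=
  Definable.allPos (Q := fun γ n => n ∈ X γ → n ∈ Y γ) (hX.imp hY)

theorem DefSet.exMem {X : Γ → Set ℕ} {Q : Γ → ℕ → Prop} (hX : DefSet X)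
    (hQ : Definable fun p : Γ × ℕ => Q p.1 p.2) : Definable fun γ => ∃ x ∈ X γ, Q γ x :=
  Definable.exPos (Q := fun γ x => x ∈ X γ ∧ Q γ x) (hX.and hQ)

theorem DefSet.allMem {X : Γ → Set ℕ} {Q : Γ → ℕ → Prop} (hX : DefSet X)
    (hQ : Definable fun p : Γ × ℕ => Q p.1 p.2) : Definable fun γ => ∀ x ∈ X γ, Q γ x :=
  Definable.allPos (Q := fun γ x => x ∈ X γ → Q γ x) (hX.imp hQ)

theorem DefSet.allSubset {X : Γ → Set ℕ} {Q : Γ → Set ℕ → Prop} (hX : DefSet X)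
    (hQ : Definable fun p : Γ × Set ℕ => Q p.1 p.2) : Definable fun γ => ∀ Y ⊆ X γ, Q γ Y :=
  Definable.allSet (Q := fun γ Y => Y ⊆ X γ → Q γ Y) ((DefSet.snd.subset hX.wkS).imp hQ)

theorem DefSet.exSubset {X : Γ → Set ℕ} {Q : Γ → Set ℕ → Prop} (hX : DefSet X)
    (hQ : Definable fun p : Γ × Set ℕ => Q p.1 p.2) : Definable fun γ => ∃ Y ⊆ X γ, Q γ Y :=
  Definable.exSet (Q := fun γ Y => Y ⊆ X γ ∧ Q γ Y) ((DefSet.snd.subset hX.wkS).and hQ)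

end MSOU

/-! ### Blocks, cells and boundedness, expressed in MSO+U -/

namespace MSOU

open Set Function Filter

/-- The number of block starts up to `x`; two positions are in the same block if this number agrees. -/
noncomputable def blockIndex (B : Set ℕ) (x : ℕ) : ℕ := {b ∈ B | b ≤ x}.ncard

def SameBlock (B : Set ℕ) (x y : ℕ) : Prop := ∀ b ∈ B, b ≤ x ↔ b ≤ y

def NextBlock (B : Set ℕ) (x y : ℕ) : Prop :=
  ∃ b ∈ B, (x < b ∧ b ≤ y) ∧ ∀ c ∈ B, c ≠ b → (c ≤ x ↔ c ≤ y)

/-- The interval which starts in `x` and ends before the next cell start. -/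
def cell (C : Set ℕ) (x : ℕ) : Set ℕ := {y | x ≤ y ∧ ∀ c ∈ C, c ≤ y → c ≤ x}

/-- The sizes of the restrictions of `F` to the cells which start in `W` are bounded. -/
def BoundedOn (C F W : Set ℕ) : Prop :=
  ¬ ∀ n : ℕ, ∃ S : Finset ℕ, n ≤ S.card ∧ ∃ x ∈ W, ∀ y ∈ (S : Set ℕ), y ∈ F ∧ y ∈ cell C x

/-- The numbers of elements of `X` in the blocks are bounded. -/
def BlockBounded (B X : Set ℕ) : Prop :=
  ¬ ∀ n : ℕ, ∃ S : Finset ℕ, n ≤ S.card ∧ (S : Set ℕ) ⊆ X ∧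
    ∀ x ∈ (S : Set ℕ), ∀ y ∈ (S : Set ℕ), SameBlock B x y

/-- `Y` has at most one element in each block. -/
def OnePerBlock (B Y : Set ℕ) : Prop := ∀ x ∈ Y, ∀ y ∈ Y, SameBlock B x y → x = y

/-- The elements of `Y` in the blocks which follow the blocks visited by `W`. -/
def partners (B Y W : Set ℕ) : Set ℕ := {y | y ∈ Y ∧ ∃ x ∈ W, NextBlock B x y}

/-- Every sequence of vectors indexed by the elements of `X` in the successive blocks is an
asymptotic mix of one indexed by the elements of `X'` in the respective next blocks. -/
def Dominated (B C X X' : Set ℕ) : Prop :=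
  ∀ F : Set ℕ, ∃ F' : Set ℕ, ∀ Y ⊆ X, OnePerBlock B Y → ∃ Y' ⊆ X', OnePerBlock B Y' ∧
    ∀ W ⊆ Y, BoundedOn C F W ↔ BoundedOn C F' (partners B Y' W)

/-- There are infinitely many blocks and cells, their sizes tend to infinity. -/
def Good (B C : Set ℕ) : Prop :=
  ((∀ n, ∃ m ∈ B, n ≤ m) ∧ ∀ n, ∃ m ∈ C, n ≤ m) ∧
  (∀ W ⊆ C, (∀ n, ∃ m ∈ W, n ≤ m) → ¬ BoundedOn C Set.univ W) ∧
  ∀ W ⊆ B, (∀ n, ∃ m ∈ W, n ≤ m) → ∀ n : ℕ, ∃ S : Finset ℕ, n ≤ S.card ∧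
    ∃ b ∈ W, ∀ x ∈ (S : Set ℕ), x ∈ C ∧ SameBlock B b x

section definability

variable {Γ : Type} [Ctx Γ] {B C F W X X' Y : Γ → Set ℕ} {x y : Γ → ℕ}

theorem DefSet.univ : DefSet fun _ : Γ => (Set.univ : Set ℕ) := by
  simpa [DefSet] using DefPos.snd.eq (DefPos.snd (Γ := Γ))

theorem DefPos.sameBlock (hB : DefSet B) (hx : DefPos x) (hy : DefPos y) :
    Definable fun γ => SameBlock (B γ) (x γ) (y γ) :=
  hB.allMem ((DefPos.snd.le hx.wkN).iff (DefPos.snd.le hy.wkN))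

theorem DefPos.nextBlock (hB : DefSet B) (hx : DefPos x) (hy : DefPos y) :
    Definable fun γ => NextBlock (B γ) (x γ) (y γ) :=
  hB.exMem (((hx.wkN.lt DefPos.snd).and (DefPos.snd.le hy.wkN)).and
    (hB.wkN.allMem ((DefPos.snd.ne DefPos.snd.wkN).imp
      ((DefPos.snd.le hx.wkN.wkN).iff (DefPos.snd.le hy.wkN.wkN)))))

theorem DefSet.cell (hC : DefSet C) (hx : DefPos x) : DefSet fun γ => cell (C γ) (x γ) :=
  Definable.and (hx.wkN.le DefPos.snd)
    (hC.wkN.allMem ((DefPos.snd.le DefPos.snd.wkN).imp (DefPos.snd.le hx.wkN.wkN)))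

theorem DefSet.boundedOn (hC : DefSet C) (hF : DefSet F) (hW : DefSet W) :
    Definable fun γ => BoundedOn (C γ) (F γ) (W γ) :=
  (Definable.unbounding
    (Q := fun γ S => ∃ x ∈ W γ, ∀ y ∈ S, y ∈ F γ ∧ y ∈ MSOU.cell (C γ) x)
    (hW.wkS.exMem (DefSet.snd.wkN.allMem ((DefPos.snd.mem hF.wkS.wkN.wkN).and
      (DefPos.snd.mem (hC.wkS.wkN.cell DefPos.snd).wkN))))).not

theorem DefSet.blockBounded (hB : DefSet B) (hX : DefSet X) :
    Definable fun γ => BlockBounded (B γ) (X γ) :=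
  (Definable.unbounding
    (Q := fun γ S => S ⊆ X γ ∧ ∀ x ∈ S, ∀ y ∈ S, SameBlock (B γ) x y)
    ((DefSet.snd.subset hX.wkS).and (DefSet.snd.allMem (DefSet.snd.wkN.allMem
      (DefPos.snd.wkN.sameBlock hB.wkS.wkN.wkN DefPos.snd))))).not

theorem DefSet.onePerBlock (hB : DefSet B) (hY : DefSet Y) :
    Definable fun γ => OnePerBlock (B γ) (Y γ) :=
  hY.allMem (hY.wkN.allMem ((DefPos.snd.wkN.sameBlock hB.wkN.wkN DefPos.snd).imp
    (DefPos.snd.wkN.eq DefPos.snd)))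

theorem DefSet.partners (hB : DefSet B) (hY : DefSet Y) (hW : DefSet W) :
    DefSet fun γ => partners (B γ) (Y γ) (W γ) :=
  Definable.and hY (hW.wkN.exMem (DefPos.snd.nextBlock hB.wkN.wkN DefPos.snd.wkN))

theorem DefSet.dominated (hB : DefSet B) (hC : DefSet C) (hX : DefSet X) (hX' : DefSet X') :
    Definable fun γ => Dominated (B γ) (C γ) (X γ) (X' γ) :=
  .allSet <| .exSet <| hX.wkS.wkS.allSubset <| (hB.wkS.wkS.wkS.onePerBlock DefSet.snd).imp <|
    hX'.wkS.wkS.wkS.exSubset <| (hB.wkS.wkS.wkS.wkS.onePerBlock DefSet.snd).and <|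
    DefSet.snd.wkS.allSubset <|
    (hC.wkS.wkS.wkS.wkS.wkS.boundedOn DefSet.snd.wkS.wkS.wkS.wkS DefSet.snd).iff
    (hC.wkS.wkS.wkS.wkS.wkS.boundedOn DefSet.snd.wkS.wkS.wkS
      (hB.wkS.wkS.wkS.wkS.wkS.partners DefSet.snd.wkS DefSet.snd))

theorem DefSet.infinite (hX : DefSet X) : Definable fun γ => ∀ n, ∃ m ∈ X γ, n ≤ m :=
  .allPos <| hX.wkN.exMem <| DefPos.snd.wkN.le DefPos.snd

theorem DefSet.good (hB : DefSet B) (hC : DefSet C) : Definable fun γ => Good (B γ) (C γ) :=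
  (hB.infinite.and hC.infinite).and <|
  (hC.allSubset <| DefSet.snd.infinite.imp (hC.wkS.boundedOn DefSet.univ DefSet.snd).not).and <|
  hB.allSubset <| DefSet.snd.infinite.imp <|
  Definable.unbounding
    (Q := fun (p : Γ × Set ℕ) S => ∃ b ∈ p.2, ∀ x ∈ S, x ∈ C p.1 ∧ SameBlock (B p.1) b x) <|
  DefSet.snd.wkS.exMem <|
  DefSet.snd.wkN.allMem <| (DefPos.snd.mem hC.wkS.wkS.wkN.wkN).and <|
  DefPos.snd.wkN.sameBlock hB.wkS.wkS.wkN.wkN DefPos.snd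

end definability

end MSOU

/-! ### Domination compares the numbers of elements per block -/

namespace MSOU

open Set Function Filter

variable {B C F W X X' : Set ℕ}

theorem finite_setOf_mem_le (B : Set ℕ) (x : ℕ) : {b ∈ B | b ≤ x}.Finite :=
  (finite_Iic x).subset fun _ h => h.2

theorem blockIndex_mono (B : Set ℕ) : Monotone (blockIndex B) := fun _ y h =>
  ncard_le_ncard (fun _ hb => ⟨hb.1, hb.2.trans h⟩) (finite_setOf_mem_le B y)

/-- The sets of block starts up to x and up to y are nested and finite, so they agree as soon as
their sizes do. -/
theorem sameBlock_iff {x y : ℕ} : SameBlock B x y ↔ blockIndex B x = blockIndex B y := by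
  constructor
  · intro h
    exact congrArg ncard (ext fun b => and_congr_right (h b))
  · have key : ∀ x y, x ≤ y → blockIndex B x = blockIndex B y → SameBlock B x y := by
      intro x y hxy h b hb
      have := eq_of_subset_of_ncard_le (s := {b ∈ B | b ≤ x}) (t := {b ∈ B | b ≤ y})
        (fun _ hb => ⟨hb.1, hb.2.trans hxy⟩) h.ge (finite_setOf_mem_le B y)
      simpa [hb] using Set.ext_iff.1 this b
    intro h
    rcases le_total x y with hxy | hxy
    · exact key x y hxy h
    · exact fun b hb => (key y x hxy h.symm b hb).symm

theorem nextBlock_iff {x y : ℕ} : NextBlock B x y ↔ blockIndex B y = blockIndex B x + 1 := by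
  constructor
  · rintro ⟨b, hb, ⟨hxb, hby⟩, h⟩
    have : {c ∈ B | c ≤ y} = insert b {c ∈ B | c ≤ x} := by
      ext c
      by_cases hc : c = b
      · subst hc; simp [hb, hby]
      · simp only [mem_ofPred_eq, mem_insert_iff, hc, false_or]
        exact and_congr_right fun hcB => (h c hcB hc).symm
    rw [blockIndex, this, ncard_insert_of_notMem (by simp [hxb]) (finite_setOf_mem_le B x)]
    rfl
  · intro h
    have hxy : x ≤ y := by
      by_contra hxy
      have := blockIndex_mono B (not_le.1 hxy).le
      omega
    have hs : {c ∈ B | c ≤ x} ⊆ {c ∈ B | c ≤ y} := fun _ hb => ⟨hb.1, hb.2.trans hxy⟩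
    have h1 : ({c ∈ B | c ≤ y} \ {c ∈ B | c ≤ x}).ncard = 1 := by
      rw [ncard_sdiff hs (finite_setOf_mem_le B x)]
      simp only [blockIndex] at h
      omega
    obtain ⟨b, hb⟩ := ncard_eq_one.1 h1
    have hm := fun c => Set.ext_iff.1 hb c
    simp only [Set.mem_sdiff, mem_ofPred_eq, not_and, not_le, mem_singleton_iff] at hm
    obtain ⟨⟨hbB, hby⟩, hbx⟩ := (hm b).2 rfl
    refine ⟨b, hbB, ⟨hbx hbB, hby⟩, fun c hc hcb => ⟨fun h => h.trans hxy, fun hcy => ?_⟩⟩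
    by_contra hcx
    exact hcb ((hm c).1 ⟨⟨hc, hcy⟩, fun _ => not_le.1 hcx⟩)

/-- A block start counts itself, so index 0 is left to the positions before the first start, and the
element of B of rank i, counted from 0, opens block i + 1. -/
theorem exists_mem_blockIndex_eq (hB : ∀ n, ∃ m ∈ B, n ≤ m) (i : ℕ) :
    ∃ b ∈ B, blockIndex B b = i + 1 := by
  classical
  have hinf : (Set.ofPred (· ∈ B)).Infinite := by
    refine infinite_of_not_bddAbove fun ⟨n, hn⟩ => ?_
    obtain ⟨m, hm, h⟩ := hB (n + 1)
    have := hn hm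
    omega
  refine ⟨Nat.nth (· ∈ B) i, Nat.nth_mem_of_infinite hinf i, ?_⟩
  rw [← Nat.count_nth_succ_of_infinite hinf i, Nat.count_eq_card_filter_range, blockIndex,
    ← ncard_coe_finset]
  congr 1
  ext b
  simp [and_comm]

/-- The elements of `X` in the block with number `i`. -/
def inBlock (B X : Set ℕ) (i : ℕ) : Set ℕ := {x ∈ X | blockIndex B x = i}

theorem finite_inBlock (hB : ∀ n, ∃ m ∈ B, n ≤ m) (X : Set ℕ) (i : ℕ) :
    (inBlock B X i).Finite := by
  obtain ⟨b, -, hb⟩ := exists_mem_blockIndex_eq hB i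
  refine (finite_Iic b).subset fun x hx => ?_
  by_contra h
  have := blockIndex_mono B (not_le.1 h).le
  have := hx.2
  omega

theorem finite_cell (hC : ∀ n, ∃ m ∈ C, n ≤ m) (x : ℕ) : (cell C x).Finite := by
  obtain ⟨c, hc, h⟩ := hC (x + 1)
  refine (finite_Iic c).subset fun y hy => ?_
  by_contra hyc
  have := hy.2 c hc (not_le.1 hyc).le
  omega

theorem disjoint_cell {x y : ℕ} (hx : x ∈ C) (hy : y ∈ C) (h : x ≠ y) :
    Disjoint (cell C x) (cell C y) :=
  disjoint_left.2 fun _ h1 h2 => h (le_antisymm (h2.2 x hx h1.1) (h1.2 y hy h2.1))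

theorem boundedOn_iff (hC : ∀ n, ∃ m ∈ C, n ≤ m) :
    BoundedOn C F W ↔ ∃ N, ∀ x ∈ W, (F ∩ cell C x).ncard ≤ N := by
  rw [BoundedOn, not_iff_comm]
  push Not
  constructor
  · intro h n
    obtain ⟨x, hx, h⟩ := h n
    have hfin := (finite_cell hC x).inter_of_right F
    refine ⟨hfin.toFinset, ?_, x, hx, by simp⟩
    rw [← ncard_eq_toFinset_card _ hfin]
    exact h.le
  · intro h n
    obtain ⟨S, hS, x, hx, h⟩ := h (n + 1)
    have := ncard_le_ncard (s := (S : Set ℕ)) (t := F ∩ cell C x) h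
      ((finite_cell hC x).inter_of_right F)
    rw [ncard_coe_finset] at this
    exact ⟨x, hx, by omega⟩

theorem blockBounded_iff (hB : ∀ n, ∃ m ∈ B, n ≤ m) :
    BlockBounded B X ↔ ∃ N, ∀ i, (inBlock B X i).ncard ≤ N := by
  rw [BlockBounded, not_iff_comm]
  push Not
  constructor
  · intro h n
    obtain ⟨i, h⟩ := h n
    have hfin := finite_inBlock hB X i
    refine ⟨hfin.toFinset, ?_, by rw [Finite.coe_toFinset]; exact fun x hx => hx.1, ?_⟩
    · rw [← ncard_eq_toFinset_card _ hfin]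
      exact h.le
    · simp only [Finite.coe_toFinset]
      exact fun x hx y hy => sameBlock_iff.2 (hx.2.trans hy.2.symm)
  · intro h n
    obtain ⟨S, hS, hSX, h⟩ := h (n + 1)
    obtain ⟨x, hx⟩ := Finset.card_pos.1 (Nat.lt_of_lt_of_le n.succ_pos hS)
    have := ncard_le_ncard (s := (S : Set ℕ)) (t := inBlock B X (blockIndex B x))
      (fun y hy => ⟨hSX hy, sameBlock_iff.1 (h y hy x hx)⟩) (finite_inBlock hB X _)
    rw [ncard_coe_finset] at this
    exact ⟨blockIndex B x, by omega⟩

/-- Cells are disjoint, so the numbers stored in them can be chosen independently, subject only to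
the lengths of the cells. -/
theorem exists_inter_cell_ncard_eq {s : ℕ → ℕ} (hs : ∀ x ∈ C, s x ≤ (cell C x).ncard) :
    ∃ F : Set ℕ, ∀ x ∈ C, (F ∩ cell C x).ncard = s x := by
  have : ∀ x, ∃ t ⊆ cell C x, x ∈ C → t.ncard = s x := fun x => by
    by_cases hx : x ∈ C
    · obtain ⟨t, h1, h2⟩ := exists_subset_card_eq (hs x hx)
      exact ⟨t, h1, fun _ => h2⟩
    · exact ⟨∅, empty_subset _, fun h => absurd h hx⟩
  choose t ht hts using this
  refine ⟨{y | ∃ x ∈ C, y ∈ t x}, fun x hx => ?_⟩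
  rw [← hts x hx]
  congr 1
  ext y
  constructor
  · rintro ⟨⟨z, hz, hy⟩, hyx⟩
    by_cases hzx : z = x
    · rwa [← hzx]
    · exact absurd hyx (disjoint_left.1 (disjoint_cell hz hx hzx) (ht z hy))
  · exact fun hy => ⟨⟨x, hx, hy⟩, ht x hy⟩

/-- Map each block of X injectively into the next block of X' and copy the stored numbers along,
truncated at the length of the target cell. Truncation does not affect boundedness, since for each N
only finitely many cells have length at most N. -/
theorem dominated_of_eventually_le (hB : ∀ n, ∃ m ∈ B, n ≤ m) (hC : ∀ n, ∃ m ∈ C, n ≤ m)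
    (hlen : ∀ n, {x ∈ C | (cell C x).ncard ≤ n}.Finite) (hX' : X' ⊆ C)
    (h : ∀ᶠ i in atTop, (inBlock B X i).ncard ≤ (inBlock B X' (i + 1)).ncard) :
    Dominated B C X X' := by
  intro F
  obtain ⟨i₀, hi₀⟩ := eventually_atTop.1 h
  have hinj : ∀ i, ∃ f : ℕ → ℕ, i₀ ≤ i →
      inBlock B X i ⊆ f ⁻¹' inBlock B X' (i + 1) ∧ InjOn f (inBlock B X i) := fun i => by
    by_cases hi : i₀ ≤ i
    · have hle := hi₀ i hi
      have hf := finite_inBlock hB X i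
      have hf' := finite_inBlock hB X' (i + 1)
      rw [← Nat.cast_le (α := ℕ∞), hf.cast_ncard_eq, hf'.cast_ncard_eq] at hle
      obtain ⟨f, hf⟩ := hf.exists_injOn_of_encard_le hle
      exact ⟨f, fun _ => hf⟩
    · exact ⟨id, fun h => absurd h hi⟩
  choose f hf using hinj
  set T : Set ℕ := {x ∈ X | i₀ ≤ blockIndex B x} with hT
  set m : ℕ → ℕ := fun x => f (blockIndex B x) x with hm
  have hmX : ∀ x ∈ T, m x ∈ X' ∧ blockIndex B (m x) = blockIndex B x + 1 :=
    fun x hx => (hf _ hx.2).1 ⟨hx.1, rfl⟩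
  have hminj : InjOn m T := by
    intro x hx y hy hxy
    have hb : blockIndex B x = blockIndex B y := by
      have h1 := (hmX x hx).2
      have h2 := (hmX y hy).2
      rw [hxy] at h1
      omega
    refine (hf _ hx.2).2 ⟨hx.1, rfl⟩ ⟨hy.1, hb.symm⟩ ?_
    simp only [hm] at hxy
    rw [hxy, hb]
  classical
  obtain ⟨F', hF'⟩ := exists_inter_cell_ncard_eq (C := C)
    (s := fun y => if h : ∃ x ∈ T, m x = y then
      min (F ∩ cell C h.choose).ncard (cell C y).ncard else 0) (fun x _ => by
      split_ifs
      · exact min_le_right _ _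
      · exact Nat.zero_le _)
  have hF'm : ∀ x ∈ T, (F' ∩ cell C (m x)).ncard =
      min (F ∩ cell C x).ncard (cell C (m x)).ncard := by
    intro x hx
    rw [hF' _ (hX' (hmX x hx).1)]
    have hex : ∃ z ∈ T, m z = m x := ⟨x, hx, rfl⟩
    rw [dif_pos hex, hminj hex.choose_spec.1 hx hex.choose_spec.2]
  refine ⟨F', fun Y hY hYone => ⟨m '' (Y ∩ T), ?_, ?_, fun W hW => ?_⟩⟩
  · rintro _ ⟨x, hx, rfl⟩
    exact (hmX x hx.2).1
  · rintro _ ⟨x, hx, rfl⟩ _ ⟨y, hy, rfl⟩ hxy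
    rw [sameBlock_iff, (hmX x hx.2).2, (hmX y hy.2).2, Nat.succ_inj] at hxy
    rw [hYone x hx.1 y hy.1 (sameBlock_iff.2 hxy)]
  · rw [boundedOn_iff hC, boundedOn_iff hC]
    have hpart : partners B (m '' (Y ∩ T)) W = m '' (W ∩ T) := by
      ext y
      constructor
      · rintro ⟨⟨x, hx, rfl⟩, z, hz, hzx⟩
        rw [nextBlock_iff, (hmX x hx.2).2, Nat.succ_inj] at hzx
        obtain rfl := hYone x hx.1 z (hW hz) (sameBlock_iff.2 hzx)
        exact ⟨x, ⟨hz, hx.2⟩, rfl⟩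
      · rintro ⟨x, hx, rfl⟩
        exact ⟨⟨x, ⟨hW hx.1, hx.2⟩, rfl⟩, x, hx.1, nextBlock_iff.2 (hmX x hx.2).2⟩
    rw [hpart]
    constructor
    · rintro ⟨N, hN⟩
      refine ⟨N, ?_⟩
      rintro _ ⟨x, hx, rfl⟩
      rw [hF'm x hx.2]
      exact (min_le_left _ _).trans (hN x hx.1)
    -- Outside a finite set of positions, the target exists and its cell is longer than N, so a
    -- truncated value of at most N was not truncated. M bounds the values on the finite set.
    · rintro ⟨N, hN⟩
      have hfin : ({x | blockIndex B x < i₀} ∪ {x ∈ T | (cell C (m x)).ncard ≤ N}).Finite := by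
        refine Finite.union ?_ ?_
        · refine ((finite_Iio i₀).biUnion fun i _ => finite_inBlock hB univ i).subset ?_
          exact fun x hx => mem_biUnion hx ⟨trivial, rfl⟩
        · exact Finite.of_injOn (f := m) (t := {x ∈ C | (cell C x).ncard ≤ N}) (fun x hx => ⟨hX' (hmX x hx.1).1, hx.2⟩)
            (hminj.mono fun x hx => hx.1) (hlen N)
      obtain ⟨M, hM⟩ := (hfin.image fun x => (F ∩ cell C x).ncard).bddAbove
      refine ⟨N + M, fun x hx => ?_⟩
      by_cases hxs : x ∈ {x | blockIndex B x < i₀} ∪ {x | x ∈ T ∧ (cell C (m x)).ncard ≤ N}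
      · exact (hM (mem_image_of_mem _ hxs)).trans (Nat.le_add_left _ _)
      · have hxT : x ∈ T := ⟨hY (hW hx), by
          by_contra h
          exact hxs (Or.inl (not_le.1 h))⟩
        have h1 : N < (cell C (m x)).ncard := by
          by_contra h
          exact hxs (Or.inr ⟨hxT, not_lt.1 h⟩)
        have h2 := hN _ ⟨x, ⟨hx, hxT⟩, rfl⟩
        rw [hF'm x hxT] at h2
        omega

theorem exists_fast_growing {ι : Type*} [LinearOrder ι] [Finite ι] (K : ι → ℕ)
    (h : ι → ι → ℕ → ℕ) : ∃ v : ι → ℕ, (∀ k, K k < v k) ∧ ∀ j k, j < k → h j k (v j) < v k := by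
  classical
  cases nonempty_fintype ι
  let v : ι → ℕ := wellFounded_lt.fix fun k ih =>
    K k + ∑ j : {j // j < k}, h j k (ih j j.2) + 1
  have hv : ∀ k, v k = K k + ∑ j : {j // j < k}, h j k (v j) + 1 := fun k =>
    wellFounded_lt.fix_eq _ k
  refine ⟨v, fun k => by rw [hv k]; omega, fun j k hjk => ?_⟩
  rw [hv k]
  have := Finset.single_le_sum (f := fun j : {j // j < k} => h j k (v j))
    (fun _ _ => Nat.zero_le _) (Finset.mem_univ ⟨j, hjk⟩)
  dsimp only at this
  omega

/-- The dimension argument: d coordinates cannot be simulated by fewer than d, because one stored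
number cannot control two coordinates that vary independently. -/
theorem eventually_le_of_dominated (hB : ∀ n, ∃ m ∈ B, n ≤ m) (hC : ∀ n, ∃ m ∈ C, n ≤ m)
    (hlen : ∀ n, {x ∈ C | (cell C x).ncard ≤ n}.Finite) (hX : X ⊆ C) (hXb : BlockBounded B X)
    (hdom : Dominated B C X X') :
    ∀ᶠ i in atTop, (inBlock B X i).ncard ≤ (inBlock B X' (i + 1)).ncard := by
  by_contra hnot
  obtain ⟨N, hN⟩ := (blockBounded_iff hB).1 hXb
  -- The counts in X are at most N, so by pigeonhole one value d occurs in infinitely many of the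
  -- bad blocks.
  obtain ⟨d, hd⟩ : ∃ d, ∃ᶠ i in atTop, (inBlock B X i).ncard = d ∧
      (inBlock B X' (i + 1)).ncard < d := by
    by_contra! hall
    have := (Finset.range (N + 1)).eventually_all.2 fun d _ => hall d
    refine hnot (this.mono fun i hi => ?_)
    have := hi _ (Finset.mem_range_succ_iff.2 (hN i))
    simpa using this
  -- An enumeration of all vectors; the default 0 at numbers that code no vector is harmless.
  set vec : ℕ → Fin d → ℕ := fun n => (Encodable.decode (α := Fin d → ℕ) n).getD 0 with hvec
  have hlarge : ∀ M, ∀ᶠ i in atTop, ∀ x ∈ inBlock B X i, M ≤ (cell C x).ncard := by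
    intro M
    obtain ⟨i, hi⟩ := ((hlen M).image (blockIndex B)).bddAbove
    filter_upwards [eventually_gt_atTop i] with k hk x hx
    by_contra hlt
    have := hi ⟨x, ⟨hX hx.1, (not_le.1 hlt).le⟩, rfl⟩
    have := hx.2
    omega
  -- The n-th vector goes to the bad block φ n, late enough that its cells can hold all coordinates.
  obtain ⟨φ, hφmono, hφ⟩ := extraction_forall_of_frequently
    (P := fun n i => ((inBlock B X i).ncard = d ∧ (inBlock B X' (i + 1)).ncard < d) ∧
      ∀ x ∈ inBlock B X i, ∑ j, vec n j ≤ (cell C x).ncard)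
    (fun n => hd.and_eventually (hlarge _))
  have henum : ∀ n, ∃ f : Fin d → ℕ, (∀ j, f j ∈ inBlock B X (φ n)) ∧ Injective f := fun n => by
    obtain ⟨f, h1, h2⟩ := (finite_univ (α := Fin d)).exists_injOn_of_encard_le
      (t := inBlock B X (φ n)) (by
        rw [← (finite_inBlock hB X _).cast_ncard_eq, (hφ n).1.1]
        simp)
    exact ⟨f, fun j => h1 (mem_univ j), injOn_univ.1 h2⟩
  choose e heX heinj using henum
  have heinj' : Injective (uncurry e) := by
    rintro ⟨n, j⟩ ⟨n', j'⟩ hnj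
    simp only [uncurry] at hnj
    have hn : φ n = φ n' := by rw [← (heX n j).2, ← (heX n' j').2, hnj]
    obtain rfl := hφmono.injective hn
    rw [heinj n hnj]
  obtain ⟨F, hF⟩ := exists_inter_cell_ncard_eq (C := C)
    (s := extend (uncurry e) (uncurry vec) 0) (fun x _ => by
      by_cases hx : ∃ p, uncurry e p = x
      · obtain ⟨⟨n, j⟩, rfl⟩ := hx
        rw [heinj'.extend_apply]
        exact (Finset.single_le_sum (f := vec n) (fun _ _ => Nat.zero_le _)
          (Finset.mem_univ j)).trans ((hφ n).2 _ (heX n j))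
      · rw [extend_apply' _ _ _ hx]
        exact Nat.zero_le _)
  have hFe : ∀ n j, (F ∩ cell C (e n j)).ncard = vec n j := fun n j =>
    (hF _ (hX (heX n j).1)).trans (heinj'.extend_apply (uncurry vec) 0 (n, j))
  obtain ⟨F', hF'⟩ := hdom F
  -- Domination is applied to the choice of the j-th coordinate in every vector. The three bounds
  -- that follow come from suitable subsets W of this choice.
  have hY : ∀ j, ∃ Y' ⊆ X', OnePerBlock B Y' ∧ ∀ W ⊆ range (e · j),
      BoundedOn C F W ↔ BoundedOn C F' (partners B Y' W) := by
    refine fun j => hF' _ ?_ ?_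
    · rintro _ ⟨n, rfl⟩
      exact (heX n j).1
    · rintro _ ⟨n, rfl⟩ _ ⟨n', rfl⟩ h
      rw [sameBlock_iff, (heX n j).2, (heX n' j).2] at h
      rw [hφmono.injective h]
  choose Y' hY'X hY'one hY' using hY
  simp only [boundedOn_iff hC] at hY'
  have hM₁ : ∀ j N, ∃ M, ∀ n, vec n j ≤ N → ∀ y ∈ Y' j, blockIndex B y = φ n + 1 →
      (F' ∩ cell C y).ncard ≤ M := by
    intro j N
    obtain ⟨M, hM⟩ := (hY' j {x | ∃ n, x = e n j ∧ vec n j ≤ N}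
      (by rintro _ ⟨n, rfl, -⟩; exact ⟨n, rfl⟩)).1 ⟨N, by
        rintro _ ⟨n, rfl, h⟩
        rwa [hFe]⟩
    exact ⟨M, fun n hn y hy hyn => hM y ⟨hy, e n j, ⟨n, rfl, hn⟩,
      nextBlock_iff.2 (by rw [hyn, (heX n j).2])⟩⟩
  have hM₂ : ∀ j N, ∃ M, ∀ n, ∀ y ∈ Y' j, blockIndex B y = φ n + 1 →
      (F' ∩ cell C y).ncard ≤ N → vec n j ≤ M := by
    intro j N
    obtain ⟨M, hM⟩ := (hY' j {x | ∃ n, x = e n j ∧ ∃ y ∈ Y' j, blockIndex B y = φ n + 1 ∧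
      (F' ∩ cell C y).ncard ≤ N} (by rintro _ ⟨n, rfl, -⟩; exact ⟨n, rfl⟩)).2 ⟨N, by
        rintro z ⟨hz, _, ⟨n, rfl, y, hy, hyn, hyN⟩, hnext⟩
        rw [nextBlock_iff, (heX n j).2] at hnext
        rwa [hY'one j z hz y hy (sameBlock_iff.2 (hnext.trans hyn.symm))]⟩
    exact ⟨M, fun n y hy hyn hyN => by
      rw [← hFe]
      exact hM _ ⟨n, rfl, y, hy, hyn, hyN⟩⟩
  -- A set of vectors whose j-th coordinate has no partner is matched with the empty set, on which
  -- everything is bounded.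
  have hK : ∀ j, ∃ M, ∀ n, (¬ ∃ y ∈ Y' j, blockIndex B y = φ n + 1) → vec n j ≤ M := by
    intro j
    obtain ⟨M, hM⟩ := (hY' j {x | ∃ n, x = e n j ∧ ¬ ∃ y ∈ Y' j, blockIndex B y = φ n + 1}
      (by rintro _ ⟨n, rfl, -⟩; exact ⟨n, rfl⟩)).2 ⟨0, by
        rintro z ⟨hz, _, ⟨n, rfl, hn⟩, hnext⟩
        rw [nextBlock_iff, (heX n j).2] at hnext
        exact absurd ⟨z, hz, hnext⟩ hn⟩
    exact ⟨M, fun n hn => by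
      rw [← hFe]
      exact hM _ ⟨n, rfl, hn⟩⟩
  choose M₁ hM₁ using hM₁
  choose M₂ hM₂ using hM₂
  choose K hK using hK
  -- Exceeding K forces every coordinate to have a partner. Exceeding M₂ k (M₁ j (v j)) prevents
  -- coordinates j < k from sharing it.
  obtain ⟨v, hvK, hv⟩ := exists_fast_growing K fun j k a => M₂ k (M₁ j a)
  obtain ⟨n, rfl⟩ : ∃ n, vec n = v := ⟨Encodable.encode v, by simp [hvec]⟩
  have hp : ∀ j, ∃ y ∈ Y' j, blockIndex B y = φ n + 1 := fun j => by
    by_contra h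
    exact (hK j n h).not_gt (hvK j)
  choose p hpY hpn using hp
  obtain ⟨j, k, hjk, hpjk⟩ : ∃ j k, j ≠ k ∧ p j = p k := by
    by_contra! h
    have hpinj : Injective p := fun j k hjk => by
      by_contra hne
      exact h j k hne hjk
    have h1 := ncard_le_ncard (s := range p) (t := inBlock B X' (φ n + 1))
      (by rintro _ ⟨j, rfl⟩; exact ⟨hY'X j (hpY j), hpn j⟩) (finite_inBlock hB X' _)
    rw [← image_univ, ncard_image_of_injective _ hpinj, ncard_univ, Nat.card_fin] at h1
    exact h1.not_gt (hφ n).1.2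
  have key : ∀ j k, j < k → p j ≠ p k := by
    intro j k hjk hp
    refine (hv j k hjk).not_ge ?_
    exact hM₂ k _ n (p k) (hpY k) (hpn k) (hp ▸ hM₁ j _ n le_rfl (p j) (hpY j) (hpn j))
  rcases lt_or_gt_of_ne hjk with h | h
  · exact key j k h hpjk
  · exact key k j h hpjk.symm

end MSOU

/-! ### Numbers represented by sets; addition and multiplication -/

namespace MSOU

open Set Function Filter

variable {B C X Y Z : Set ℕ}

theorem Good.finite_small (h : Good B C) (n : ℕ) : {x ∈ C | (cell C x).ncard ≤ n}.Finite := by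
  by_contra hinf
  refine h.2.1 {x ∈ C | (cell C x).ncard ≤ n} (fun _ h => h.1) (fun m => ?_)
    ((boundedOn_iff h.1.2).2 ⟨n, fun x hx => by simpa using hx.2⟩)
  obtain ⟨k, hk, h⟩ := Set.Infinite.exists_gt hinf m
  exact ⟨k, hk, h.le⟩

theorem Good.eventually_large (h : Good B C) (n : ℕ) :
    ∀ᶠ i in atTop, n ≤ (inBlock B C i).ncard := by
  by_contra hnot
  simp only [not_eventually, not_le] at hnot
  obtain ⟨S, hS, b, hb, hSb⟩ := h.2.2 {b ∈ B | (inBlock B C (blockIndex B b)).ncard < n}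
    (fun _ h => h.1) (fun m => by
      obtain ⟨i, hi, hin⟩ := frequently_atTop'.1 hnot (blockIndex B m)
      -- Since i exceeds `blockIndex B m`, it is positive, so block i is opened by an element of B.
      obtain ⟨b, hb, hbi⟩ := exists_mem_blockIndex_eq h.1.1 (i - 1)
      rw [Nat.sub_add_cancel (by omega)] at hbi
      refine ⟨b, ⟨hb, by rwa [hbi]⟩, ?_⟩
      by_contra hlt
      have := blockIndex_mono B (not_le.1 hlt).le
      omega) n
  have := ncard_le_ncard (s := (S : Set ℕ)) (t := inBlock B C (blockIndex B b))
    (fun x hx => ⟨(hSb x hx).1, (sameBlock_iff.1 (hSb x hx).2).symm⟩) (finite_inBlock h.1.1 _ _)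
  rw [ncard_coe_finset] at this
  exact (hS.trans this).not_gt hb.2

/-- `X` represents `n`: all but finitely many blocks have `n` elements of `X`. -/
def Rep (B C X : Set ℕ) (n : ℕ) : Prop := X ⊆ C ∧ ∀ᶠ i in atTop, (inBlock B X i).ncard = n

/-- A definable formulation of `∃ n, Rep B C X n`. -/
def IsNum (B C X : Set ℕ) : Prop := X ⊆ C ∧ BlockBounded B X ∧ Dominated B C X X

/-- A definable formulation of `∃ n, Rep B C X n ∧ Rep B C Y n`, if `Y` represents a number. -/
def SameNum (B C X Y : Set ℕ) : Prop := IsNum B C X ∧ Dominated B C X Y ∧ Dominated B C Y X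

theorem Rep.unique {n m : ℕ} (h : Rep B C X n) (h' : Rep B C X m) : n = m := by
  obtain ⟨i, h1, h2⟩ := (h.2.and h'.2).exists
  exact h1.symm.trans h2

theorem Rep.blockBounded (h : Good B C) {n : ℕ} (hX : Rep B C X n) : BlockBounded B X := by
  rw [blockBounded_iff h.1.1]
  obtain ⟨i₀, hi₀⟩ := eventually_atTop.1 hX.2
  obtain ⟨M, hM⟩ := ((finite_Iio i₀).image fun i => (inBlock B X i).ncard).bddAbove
  refine ⟨n + M, fun i => ?_⟩
  rcases lt_or_ge i i₀ with hi | hi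
  · exact (hM (mem_image_of_mem (fun i => (inBlock B X i).ncard) hi)).trans (Nat.le_add_left _ _)
  · rw [hi₀ i hi]
    exact Nat.le_add_right _ _

theorem dominated_iff_eventually (h : Good B C) (hX : X ⊆ C) (hXb : BlockBounded B X)
    (hY : Y ⊆ C) : Dominated B C X Y ↔
      ∀ᶠ i in atTop, (inBlock B X i).ncard ≤ (inBlock B Y (i + 1)).ncard :=
  ⟨eventually_le_of_dominated h.1.1 h.1.2 h.finite_small hX hXb,
    dominated_of_eventually_le h.1.1 h.1.2 h.finite_small hY⟩

theorem Rep.dominated_iff (h : Good B C) {n m : ℕ} (hX : Rep B C X n) (hY : Rep B C Y m) :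
    Dominated B C X Y ↔ n ≤ m := by
  rw [dominated_iff_eventually h hX.1 (hX.blockBounded h) hY.1]
  have hY' := (tendsto_add_atTop_nat 1).eventually hY.2
  constructor
  · intro hle
    obtain ⟨i, h1, h2, h3⟩ := (hle.and (hX.2.and hY')).exists
    rwa [h2, h3] at h1
  · intro hle
    filter_upwards [hX.2, hY'] with i h1 h2
    rwa [h1, h2]

theorem eventually_const_of_eventually_le_succ {a : ℕ → ℕ} {N : ℕ} (hN : ∀ i, a i ≤ N)
    (ha : ∀ᶠ i in atTop, a i ≤ a (i + 1)) : ∃ n, ∀ᶠ i in atTop, a i = n := by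
  obtain ⟨i₀, hi₀⟩ := eventually_atTop.1 ha
  have hmono : Monotone fun i => a (i₀ + i) :=
    monotone_nat_of_le_succ fun i => hi₀ _ (Nat.le_add_right _ _)
  obtain ⟨_, ⟨⟨k, rfl⟩, hk⟩⟩ := (Set.finite_iff_bddAbove.2 ⟨N, by
    rintro _ ⟨i, rfl⟩; exact hN _⟩ : (range fun i => a (i₀ + i)).Finite).exists_maximal
      (range_nonempty _)
  refine ⟨a (i₀ + k), eventually_atTop.2 ⟨i₀ + k, fun i hi => ?_⟩⟩
  obtain ⟨j, rfl⟩ := Nat.exists_eq_add_of_le hi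
  have h1 := hmono (Nat.le_add_right k j)
  have h2 := hk ⟨k + j, rfl⟩ h1
  simp only [← add_assoc] at h1 h2
  exact le_antisymm h2 h1

/-- By self-domination the count in block i is at most that in block i + 1 for almost all i, and a
bounded, eventually monotone sequence of naturals is eventually constant. Comparing with the next
block, not the same one, is what makes this work. -/
theorem isNum_iff (h : Good B C) : IsNum B C X ↔ ∃ n, Rep B C X n := by
  constructor
  · rintro ⟨hX, hXb, hdom⟩
    obtain ⟨N, hN⟩ := (blockBounded_iff h.1.1).1 hXb
    obtain ⟨n, hn⟩ := eventually_const_of_eventually_le_succ hN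
      ((dominated_iff_eventually h hX hXb hX).1 hdom)
    exact ⟨n, hX, hn⟩
  · rintro ⟨n, hX⟩
    exact ⟨hX.1, hX.blockBounded h, (hX.dominated_iff h hX).2 le_rfl⟩

theorem Rep.sameNum_iff (h : Good B C) {n : ℕ} (hY : Rep B C Y n) :
    SameNum B C X Y ↔ Rep B C X n := by
  constructor
  · rintro ⟨hX, hXY, hYX⟩
    obtain ⟨m, hm⟩ := (isNum_iff h).1 hX
    rwa [le_antisymm ((hY.dominated_iff h hm).1 hYX) ((hm.dominated_iff h hY).1 hXY)]
  · exact fun hX => ⟨(isNum_iff h).2 ⟨n, hX⟩, (hX.dominated_iff h hY).2 le_rfl,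
      (hY.dominated_iff h hX).2 le_rfl⟩

theorem inBlock_union (X Y : Set ℕ) (i : ℕ) :
    inBlock B (X ∪ Y) i = inBlock B X i ∪ inBlock B Y i := by
  ext x
  simp [inBlock, or_and_right]

theorem Rep.union (h : Good B C) {n m : ℕ} (hX : Rep B C X n) (hY : Rep B C Y m)
    (hXY : Disjoint X Y) : Rep B C (X ∪ Y) (n + m) := by
  refine ⟨union_subset hX.1 hY.1, ?_⟩
  filter_upwards [hX.2, hY.2] with i h1 h2
  rw [inBlock_union, ncard_union_eq (hXY.mono (fun _ h => h.1) (fun _ h => h.1))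
    (finite_inBlock h.1.1 _ _) (finite_inBlock h.1.1 _ _), h1, h2]

theorem Rep.empty (B C : Set ℕ) : Rep B C ∅ 0 :=
  ⟨empty_subset _, Eventually.of_forall fun i => by simp [inBlock]⟩

/-- The first `n` cell starts in almost every block, listed in increasing order. -/
theorem Good.exists_enum (h : Good B C) (n : ℕ) : ∃ (i₀ : ℕ) (c : ℕ → ℕ → ℕ), ∀ i ≥ i₀,
    (∀ k < n, c i k ∈ inBlock B C i) ∧ ∀ k < n, ∀ l < n, c i k ≤ c i l → k ≤ l := by
  obtain ⟨i₀, hi₀⟩ := eventually_atTop.1 (h.eventually_large n)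
  have : ∀ i, ∃ c : ℕ → ℕ, i₀ ≤ i → (∀ k < n, c k ∈ inBlock B C i) ∧
      ∀ k < n, ∀ l < n, c k ≤ c l → k ≤ l := fun i => by
    by_cases hi : i₀ ≤ i
    · obtain ⟨t, ht, htn⟩ := exists_subset_card_eq (hi₀ i hi)
      have hfin := (finite_inBlock h.1.1 C i).subset ht
      rw [ncard_eq_toFinset_card _ hfin] at htn
      refine ⟨fun k => if hk : k < n then hfin.toFinset.orderEmbOfFin htn ⟨k, hk⟩ else 0,
        fun _ => ⟨fun k hk => ?_, fun k hk l hl hkl => ?_⟩⟩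
      · dsimp only
        rw [dif_pos hk]
        exact ht (hfin.mem_toFinset.1 (Finset.orderEmbOfFin_mem _ htn _))
      · dsimp only at hkl
        rw [dif_pos hk, dif_pos hl, OrderEmbedding.le_iff_le] at hkl
        exact hkl
    · exact ⟨id, fun h => absurd h hi⟩
  choose c hc using this
  exact ⟨i₀, c, hc⟩

/-- Selecting the same indices s in each enumerated block represents the cardinality of s. -/
theorem rep_of_enum {n m i₀ : ℕ} {c : ℕ → ℕ → ℕ} (hc : ∀ i ≥ i₀,
    (∀ k < n, c i k ∈ inBlock B C i) ∧ ∀ k < n, ∀ l < n, c i k ≤ c i l → k ≤ l)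
    {s : Finset ℕ} (hs : ∀ k ∈ s, k < n) (hsm : s.card = m) :
    Rep B C {x | ∃ i ≥ i₀, ∃ k ∈ s, x = c i k} m := by
  constructor
  · rintro _ ⟨i, hi, k, hk, rfl⟩
    exact ((hc i hi).1 k (hs k hk)).1
  · filter_upwards [eventually_ge_atTop i₀] with i hi
    have : inBlock B {x | ∃ i ≥ i₀, ∃ k ∈ s, x = c i k} i = c i '' s := by
      ext x
      constructor
      · rintro ⟨⟨j, hj, k, hk, rfl⟩, hx⟩
        have := ((hc j hj).1 k (hs k hk)).2
        obtain rfl : j = i := this.symm.trans hx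
        exact ⟨k, hk, rfl⟩
      · rintro ⟨k, hk, rfl⟩
        exact ⟨⟨i, hi, k, hk, rfl⟩, ((hc i hi).1 k (hs k hk)).2⟩
    rw [this, InjOn.ncard_image, ncard_coe_finset, hsm]
    intro k hk l hl hkl
    exact le_antisymm ((hc i hi).2 k (hs k hk) l (hs l hl) hkl.le)
      ((hc i hi).2 l (hs l hl) k (hs k hk) hkl.ge)

theorem Good.exists_rep (h : Good B C) (n : ℕ) : ∃ X, Rep B C X n := by
  obtain ⟨i₀, c, hc⟩ := h.exists_enum n
  exact ⟨_, rep_of_enum hc (s := Finset.range n) (by simp) (by simp)⟩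

/-- The sum of the numbers represented by `X` and `Y` is the one represented by `Z`. -/
def AddRel (B C X Y Z : Set ℕ) : Prop :=
  ∃ X', SameNum B C X' X ∧ ∃ Y', SameNum B C Y' Y ∧ (∀ x ∈ X', x ∉ Y') ∧
    SameNum B C (X' ∪ Y') Z

theorem addRel_iff (h : Good B C) {x y z : ℕ} (hX : Rep B C X x) (hY : Rep B C Y y)
    (hZ : Rep B C Z z) : AddRel B C X Y Z ↔ x + y = z := by
  simp only [AddRel, hX.sameNum_iff h, hY.sameNum_iff h, hZ.sameNum_iff h]
  constructor
  · rintro ⟨X', hX', Y', hY', hXY, hZ⟩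
    exact (hX'.union h hY' (disjoint_left.2 hXY)).unique hZ
  · rintro rfl
    -- The indices below x represent the first summand, those from x to x + y - 1 the second.
    obtain ⟨i₀, c, hc⟩ := h.exists_enum (x + y)
    have h1 := rep_of_enum hc (s := Finset.range x) (m := x)
      (fun k hk => by rw [Finset.mem_range] at hk; omega) (by simp)
    have h2 := rep_of_enum hc (s := Finset.Ico x (x + y)) (m := y)
      (fun k hk => (Finset.mem_Ico.1 hk).2) (by simp)
    have hdisj : ∀ w ∈ {w | ∃ i ≥ i₀, ∃ k ∈ Finset.range x, w = c i k},
        w ∉ {w | ∃ i ≥ i₀, ∃ k ∈ Finset.Ico x (x + y), w = c i k} := by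
      rintro _ ⟨i, hi, k, hk, rfl⟩ ⟨j, hj, l, hl, hkl⟩
      rw [Finset.mem_range] at hk
      rw [Finset.mem_Ico] at hl
      have e1 := ((hc i hi).1 k (by omega)).2
      have e2 := ((hc j hj).1 l hl.2).2
      rw [← hkl] at e2
      obtain rfl := e1.symm.trans e2
      have := (hc i hi).2 l hl.2 k (by omega) hkl.ge
      omega
    exact ⟨_, h1, _, h2, hdisj, h1.union h h2 (disjoint_left.2 hdisj)⟩

/-- The elements of `W` for which the last element of `R` before them is in the same block, and is
an element of `T`. -/
def rows (B R W T : Set ℕ) : Set ℕ :=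
  {w | w ∈ W ∧ ∃ r ∈ T, SameBlock B r w ∧ r ≤ w ∧ ∀ s ∈ R, s ≤ w → s ≤ r}

/-- The product of the numbers represented by `X` and `Y` is the one represented by `Z`. -/
def MulRel (B C X Y Z : Set ℕ) : Prop :=
  ∃ R, SameNum B C R X ∧ ∃ W, SameNum B C W Z ∧ W ⊆ rows B R W R ∧
    ∀ T ⊆ R, IsNum B C T → OnePerBlock B T → ¬ Dominated B C T ∅ → SameNum B C (rows B R W T) Y

/-- The empty set represents 0, so not being dominated by it excludes 0, while one element per block
excludes numbers above 1. -/
theorem rep_one_of_onePerBlock (h : Good B C) (hX : IsNum B C X) (h1 : OnePerBlock B X)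
    (h0 : ¬ Dominated B C X ∅) : Rep B C X 1 := by
  obtain ⟨n, hn⟩ := (isNum_iff h).1 hX
  rw [hn.dominated_iff h (Rep.empty B C)] at h0
  obtain ⟨i, hi⟩ := hn.2.exists
  have : (inBlock B X i).ncard ≤ 1 := by
    rw [ncard_le_one (finite_inBlock h.1.1 X i)]
    exact fun x hx y hy => h1 x hx.1 y hy.1 (sameBlock_iff.2 (hx.2.trans hy.2.symm))
  obtain rfl : n = 1 := by omega
  exact hn

/-- If infinitely many blocks had a root in R whose row does not have y elements, a set T picking
one such root wherever possible would contradict the hypothesis on T. So in almost all blocks W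
splits into x rows of size y. -/
theorem rep_mul_of_rows (h : Good B C) {R W : Set ℕ} {x y z : ℕ} (hR : Rep B C R x)
    (hW : Rep B C W z) (hWR : W ⊆ rows B R W R)
    (hT : ∀ T ⊆ R, IsNum B C T → OnePerBlock B T → ¬ Dominated B C T ∅ →
      Rep B C (rows B R W T) y) : x * y = z := by
  classical
  have hrow : ∀ᶠ i : ℕ in atTop, ∀ r : ℕ, r ∈ inBlock B R i → (rows B R W ({r} : Set ℕ)).ncard = y := by
    by_contra hnot
    simp only [not_eventually] at hnot
    push Not at hnot
    -- Positivity of x lets T pick a root also in the blocks that have no bad one.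
    have hx : x ≠ 0 := by
      rintro rfl
      obtain ⟨i, ⟨r, hr, -⟩, hi⟩ := (hnot.and_eventually hR.2).exists
      rw [ncard_eq_zero (finite_inBlock h.1.1 R i)] at hi
      exact notMem_empty r (hi ▸ hr)
    have ht : ∀ i, ∃ t, (inBlock B R i).ncard = x → t ∈ inBlock B R i ∧
        ((∃ r ∈ inBlock B R i, (rows B R W ({r} : Set ℕ)).ncard ≠ y) → (rows B R W ({t} : Set ℕ)).ncard ≠ y) :=
      fun i => by
        by_cases hi : ∃ r ∈ inBlock B R i, (rows B R W ({r} : Set ℕ)).ncard ≠ y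
        · obtain ⟨r, hr, hry⟩ := hi
          exact ⟨r, fun _ => ⟨hr, fun _ => hry⟩⟩
        · by_cases hix : (inBlock B R i).ncard = x
          · obtain ⟨r, hr⟩ := nonempty_of_ncard_ne_zero (hix.trans_ne hx)
            exact ⟨r, fun _ => ⟨hr, fun h => absurd h hi⟩⟩
          · exact ⟨0, fun h => absurd h hix⟩
    choose t ht using ht
    set T : Set ℕ := {r | r ∈ R ∧ r = t (blockIndex B r)} with hTdef
    have hTR : T ⊆ R := fun r hr => hr.1
    have hTi : ∀ i, (inBlock B R i).ncard = x → inBlock B T i = {t i} := fun i hi => by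
      obtain ⟨h1, -⟩ := ht i hi
      ext r
      constructor
      · rintro ⟨⟨-, hr⟩, rfl⟩
        exact hr
      · rintro rfl
        exact ⟨⟨h1.1, by rw [h1.2]⟩, h1.2⟩
    have hT1 : Rep B C T 1 := ⟨hTR.trans hR.1, hR.2.mono fun i hi => by
      rw [hTi i hi, ncard_singleton]⟩
    have hTy := hT T hTR ((isNum_iff h).2 ⟨1, hT1⟩) (fun r hr s hs hrs => by
      rw [hr.2, hs.2, sameBlock_iff.1 hrs])
      (by rw [hT1.dominated_iff h (Rep.empty B C)]; omega)
    obtain ⟨i, hbad, hRi, hTyi⟩ := (hnot.and_eventually (hR.2.and hTy.2)).exists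
    refine (ht i hRi).2 hbad ?_
    rw [← hTyi]
    congr 1
    ext w
    constructor
    · rintro ⟨hw, _, rfl, hsb, hle, hs⟩
      have hti := (ht i hRi).1.2
      have : t i ∈ inBlock B T i := by rw [hTi i hRi]; rfl
      exact ⟨⟨hw, _, this.1, hsb, hle, hs⟩, (sameBlock_iff.1 hsb).symm.trans hti⟩
    · rintro ⟨⟨hw, r, hr, hsb, hle, hs⟩, hwi⟩
      have hri : r ∈ inBlock B T i := ⟨hr, (sameBlock_iff.1 hsb).trans hwi⟩
      rw [hTi i hRi] at hri
      exact ⟨hw, r, hri, hsb, hle, hs⟩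
  obtain ⟨i, hrow, hRi, hWi⟩ := (hrow.and (hR.2.and hW.2)).exists
  have hrowOf : ∀ w, ∃ r, w ∈ W → r ∈ R ∧ SameBlock B r w ∧ r ≤ w ∧ ∀ s ∈ R, s ≤ w → s ≤ r :=
    fun w => by
      by_cases hw : w ∈ W
      · obtain ⟨r, hr⟩ := (hWR hw).2
        exact ⟨r, fun _ => hr⟩
      · exact ⟨0, fun h => absurd h hw⟩
  choose f hf using hrowOf
  have hWfin := finite_inBlock h.1.1 W i
  have hRfin := finite_inBlock h.1.1 R i
  have hcard := Finset.card_eq_sum_card_fiberwise (s := hWfin.toFinset) (t := hRfin.toFinset)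
    (f := f) (fun w hw => by
      simp only [Finite.coe_toFinset] at hw ⊢
      exact ⟨(hf w hw.1).1, (sameBlock_iff.1 (hf w hw.1).2.1).trans hw.2⟩)
  rw [Finset.sum_const_nat (m := y), ← ncard_eq_toFinset_card _ hWfin,
    ← ncard_eq_toFinset_card _ hRfin, hRi, hWi] at hcard
  · exact hcard.symm
  · intro r hr
    rw [Finite.mem_toFinset] at hr
    rw [← hrow r hr, ← ncard_coe_finset]
    congr 1
    ext w
    simp only [Finset.coe_filter, Finite.mem_toFinset, mem_ofPred_eq]
    constructor
    · rintro ⟨hw, rfl⟩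
      exact ⟨hw.1, _, rfl, (hf w hw.1).2⟩
    · rintro ⟨hw, _, rfl, hsb, hle, hs⟩
      refine ⟨⟨hw, (sameBlock_iff.1 hsb).symm.trans hr.2⟩, ?_⟩
      exact le_antisymm (hs _ (hf w hw).1 (hf w hw).2.2.1)
        ((hf w hw).2.2.2 _ hr.1 hle)

/-- In almost every block take x(y + 1) cell starts in increasing order, as x consecutive groups of
y + 1. The first of each group goes to R, the other y go to W. -/
theorem exists_rows (h : Good B C) (x y : ℕ) : ∃ R W, Rep B C R x ∧ Rep B C W (x * y) ∧
    W ⊆ rows B R W R ∧ ∀ T ⊆ R, Rep B C T 1 → Rep B C (rows B R W T) y := by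
  obtain ⟨i₀, c, hc⟩ := h.exists_enum (x * (y + 1))
  have hlt : ∀ {a b}, a < x → b ≤ y → a * (y + 1) + b < x * (y + 1) := fun {a b} ha hb => by
    nlinarith [Nat.mul_le_mul_right (y + 1) (Nat.succ_le_of_lt ha)]
  have h0 : ∀ a < x, a * (y + 1) < x * (y + 1) := fun a ha => hlt (b := 0) ha (Nat.zero_le _)
  set s : Finset ℕ := (Finset.range x).image fun a => a * (y + 1) with hs
  set u : Finset ℕ := (Finset.range x ×ˢ Finset.range y).image
    fun p => p.1 * (y + 1) + (p.2 + 1) with hu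
  -- Indices a(y + 1) + b with b ≤ y are ordered lexicographically, so a larger index cannot lie in
  -- an earlier group.
  have hdiv : ∀ a b a' b', b ≤ y → b' ≤ y → a * (y + 1) + b ≤ a' * (y + 1) + b' → a ≤ a' := by
    intro a b a' b' hb hb' hle
    by_contra hlt
    nlinarith [Nat.mul_le_mul_right (y + 1) (Nat.succ_le_of_lt (not_le.1 hlt))]
  have hslt : ∀ k ∈ s, k < x * (y + 1) := by
    intro k hk
    obtain ⟨a, ha, rfl⟩ := Finset.mem_image.1 hk
    exact h0 a (Finset.mem_range.1 ha)
  have hult : ∀ k ∈ u, k < x * (y + 1) := by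
    intro k hk
    obtain ⟨⟨a, b⟩, hab, rfl⟩ := Finset.mem_image.1 hk
    simp only [Finset.mem_product, Finset.mem_range] at hab
    exact hlt hab.1 hab.2
  have hR := rep_of_enum hc (m := x) hslt (by
    rw [hs, Finset.card_image_of_injective _ (mul_left_injective₀ y.succ_ne_zero),
      Finset.card_range])
  have hW := rep_of_enum hc (m := x * y) hult (by
    rw [hu, Finset.card_image_of_injOn, Finset.card_product, Finset.card_range,
      Finset.card_range]
    rintro ⟨a, b⟩ hab ⟨a', b'⟩ hab' he
    simp only [Finset.coe_product, Finset.coe_range, mem_prod, mem_Iio] at hab hab' he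
    obtain rfl := le_antisymm (hdiv a (b + 1) a' (b' + 1) hab.2 hab'.2 he.le)
      (hdiv a' (b' + 1) a (b + 1) hab'.2 hab.2 he.ge)
    simp only [Prod.mk.injEq, true_and]
    omega)
  set R := {w | ∃ i ≥ i₀, ∃ k ∈ s, w = c i k} with hRdef
  set W := {w | ∃ i ≥ i₀, ∃ k ∈ u, w = c i k} with hWdef
  have hbl : ∀ i ≥ i₀, ∀ k < x * (y + 1), blockIndex B (c i k) = i :=
    fun i hi k hk => ((hc i hi).1 k hk).2
  have hlast : ∀ i ≥ i₀, ∀ a < x, ∀ b ≤ y, ∀ r ∈ R, r ≤ c i (a * (y + 1) + b) →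
      r ≤ c i (a * (y + 1)) := by
    rintro i hi a ha b hb _ ⟨j, hj, k, hk, rfl⟩ hle
    obtain ⟨a', ha', rfl⟩ := Finset.mem_image.1 hk
    rw [Finset.mem_range] at ha'
    have hji := blockIndex_mono B hle
    rw [hbl j hj _ (h0 a' ha'), hbl i hi _ (hlt ha hb)] at hji
    by_contra hgt
    have hij := blockIndex_mono B (not_le.1 hgt).le
    rw [hbl j hj _ (h0 a' ha'), hbl i hi _ (h0 a ha)] at hij
    obtain rfl := le_antisymm hji hij
    have haa := hdiv a' 0 a b (Nat.zero_le _) hb ((hc j hj).2 _ (h0 a' ha') _ (hlt ha hb) hle)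
    have := (hc j hj).2 _ (h0 a ha) _ (h0 a' ha') (not_le.1 hgt).le
    have := hdiv a 0 a' 0 (Nat.zero_le _) (Nat.zero_le _) this
    obtain rfl := le_antisymm haa this
    exact hgt le_rfl
  have hle0 : ∀ i ≥ i₀, ∀ a < x, ∀ b ≤ y, c i (a * (y + 1)) ≤ c i (a * (y + 1) + b) := by
    intro i hi a ha b hb
    rcases Nat.eq_zero_or_pos b with rfl | hb0
    · exact le_rfl
    · by_contra hgt
      have := (hc i hi).2 _ (hlt ha hb) _ (h0 a ha) (not_le.1 hgt).le
      omega
  have hcR : ∀ i ≥ i₀, ∀ a < x, c i (a * (y + 1)) ∈ R := fun i hi a ha =>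
    ⟨i, hi, _, Finset.mem_image_of_mem _ (Finset.mem_range.2 ha), rfl⟩
  have hmem : ∀ i ≥ i₀, ∀ a < x, ∀ b < y, ∀ T ⊆ R,
      c i (a * (y + 1) + (b + 1)) ∈ rows B R W T ↔ c i (a * (y + 1)) ∈ T := by
    intro i hi a ha b hb T hTR
    constructor
    · rintro ⟨-, r, hr, hsb, hle, hmax⟩
      have h1 := hlast i hi a ha (b + 1) hb r (hTR hr) hle
      have h2 := hmax _ (hcR i hi a ha) (hle0 i hi a ha (b + 1) hb)
      rwa [← le_antisymm h1 h2]
    · intro hT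
      refine ⟨⟨i, hi, _, Finset.mem_image.2 ⟨(a, b), by simp [ha, hb], rfl⟩, rfl⟩, _, hT, ?_,
        hle0 i hi a ha (b + 1) hb, hlast i hi a ha (b + 1) hb⟩
      rw [sameBlock_iff, hbl i hi _ (h0 a ha), hbl i hi _ (hlt ha hb)]
  refine ⟨R, W, hR, hW, ?_, fun T hTR hT => ⟨fun w hw => hW.1 hw.1, ?_⟩⟩
  · intro w hw
    obtain ⟨i, hi, k, hk, rfl⟩ := hw
    obtain ⟨⟨a, b⟩, hab, rfl⟩ := Finset.mem_image.1 hk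
    simp only [Finset.mem_product, Finset.mem_range] at hab
    exact (hmem i hi a hab.1 b hab.2 R Subset.rfl).2 (hcR i hi a hab.1)
  · filter_upwards [hT.2, eventually_ge_atTop i₀] with i hTi hi
    obtain ⟨t, ht⟩ := ncard_eq_one.1 hTi
    have htT : t ∈ inBlock B T i := by rw [ht]; rfl
    obtain ⟨j, hj, k, hk, rfl⟩ := hTR htT.1
    have hkj := htT.2
    rw [hbl j hj k (hslt k hk)] at hkj
    obtain rfl := hkj
    obtain ⟨a, ha, rfl⟩ := Finset.mem_image.1 hk
    rw [Finset.mem_range] at ha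
    have : inBlock B (rows B R W T) j =
        (fun b => c j (a * (y + 1) + (b + 1))) '' (Finset.range y : Set ℕ) := by
      ext w
      constructor
      · rintro ⟨hw, hwj⟩
        obtain ⟨i', hi', k, hk', rfl⟩ := hw.1
        rw [hbl i' hi' k (hult k hk')] at hwj
        obtain rfl := hwj
        obtain ⟨⟨a', b⟩, hab, rfl⟩ := Finset.mem_image.1 hk'
        simp only [Finset.mem_product, Finset.mem_range] at hab
        have h1 : c i' (a' * (y + 1)) ∈ inBlock B T i' :=
          ⟨(hmem i' hi a' hab.1 b hab.2 T hTR).1 hw, hbl i' hi _ (h0 a' hab.1)⟩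
        rw [ht, mem_singleton_iff] at h1
        have h2 := (hc i' hi).2 _ (h0 a' hab.1) _
          (h0 a ha) h1.le
        have h3 := (hc i' hi).2 _ (h0 a ha) _
          (h0 a' hab.1) h1.ge
        obtain rfl := le_antisymm (hdiv a' 0 a 0 (Nat.zero_le _) (Nat.zero_le _) h2)
          (hdiv a 0 a' 0 (Nat.zero_le _) (Nat.zero_le _) h3)
        exact ⟨b, by simpa using hab.2, rfl⟩
      · rintro ⟨b, hb, rfl⟩
        have hb : b < y := by simpa using hb
        exact ⟨(hmem j hi a ha b hb T hTR).2 htT.1, hbl j hi _ (hlt ha hb)⟩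
    rw [this, InjOn.ncard_image, ncard_coe_finset, Finset.card_range]
    intro b hb b' hb' he
    have hb : b < y := by simpa using hb
    have hb' : b' < y := by simpa using hb'
    have h2 := (hc j hi).2 _ (hlt ha hb) _ (hlt ha hb') (le_of_eq he)
    have h3 := (hc j hi).2 _ (hlt ha hb') _ (hlt ha hb) (ge_of_eq he)
    omega

theorem mulRel_iff (h : Good B C) {x y z : ℕ} (hX : Rep B C X x) (hY : Rep B C Y y)
    (hZ : Rep B C Z z) : MulRel B C X Y Z ↔ x * y = z := by
  simp only [MulRel, hX.sameNum_iff h, hY.sameNum_iff h, hZ.sameNum_iff h]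
  constructor
  · rintro ⟨R, hR, W, hW, hWR, hT⟩
    exact rep_mul_of_rows h hR hW hWR hT
  · rintro rfl
    obtain ⟨R, W, hR, hW, hWR, hT⟩ := exists_rows h x y
    exact ⟨R, hR, W, hW, hWR, fun T hTR hT1 hT2 hT3 =>
      hT T hTR (rep_one_of_onePerBlock h hT1 hT2 hT3)⟩

end MSOU

/-! ### Existence of a good partition; definability of the arithmetic relations -/

namespace MSOU

open Set Function Filter

/-- Cells start at the squares and blocks at the fourth powers. The cell at m² has length 2m + 1,
and the block at m⁴ contains (m² + k)² for all k ≤ 2m. -/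
theorem exists_good : ∃ B C, Good B C := by
  refine ⟨range fun m => (m ^ 2) ^ 2, range fun m => m ^ 2, ⟨fun n => ⟨_, ⟨n, rfl⟩, ?_⟩,
    fun n => ⟨_, ⟨n, rfl⟩, ?_⟩⟩, fun W hW hinf => not_not.2 fun n => ?_, fun W hW hinf n => ?_⟩
  · exact (Nat.le_self_pow two_ne_zero n).trans (Nat.le_self_pow two_ne_zero _)
  · exact Nat.le_self_pow two_ne_zero n
  · obtain ⟨x, hx, hnx⟩ := hinf (n ^ 2)
    obtain ⟨m, rfl⟩ := hW hx
    have hnm : n ≤ m := (Nat.pow_le_pow_iff_left two_ne_zero).1 hnx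
    refine ⟨Finset.Ico (m ^ 2) (m ^ 2 + n), by simp, _, hx, fun y hy => ⟨trivial, ?_⟩⟩
    simp only [Finset.coe_Ico, mem_Ico] at hy
    refine ⟨hy.1, ?_⟩
    rintro _ ⟨k, rfl⟩ hky
    have : k < m + 1 := lt_of_pow_lt_pow_left₀ 2 (Nat.zero_le _) (by dsimp only at hky; nlinarith)
    exact Nat.pow_le_pow_left (Nat.lt_succ_iff.1 this) 2
  · obtain ⟨x, hx, hnx⟩ := hinf ((n ^ 2) ^ 2)
    obtain ⟨m, rfl⟩ := hW hx
    have hnm : n ≤ m := (Nat.pow_le_pow_iff_left two_ne_zero).1 ((Nat.pow_le_pow_iff_left two_ne_zero).1 hnx)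
    refine ⟨(Finset.range n).image fun k => (m ^ 2 + k) ^ 2, ?_, _, hx, ?_⟩
    · rw [Finset.card_image_of_injective, Finset.card_range]
      intro a b hab
      exact Nat.add_left_cancel (Nat.pow_left_injective two_ne_zero hab)
    · simp only [Finset.coe_image, Finset.coe_range]
      rintro _ ⟨k, hk, rfl⟩
      refine ⟨⟨_, rfl⟩, ?_⟩
      rintro _ ⟨l, rfl⟩
      constructor
      · exact fun h => h.trans (Nat.pow_le_pow_left (Nat.le_add_right _ _) 2)
      · intro h
        have h1 : l ^ 2 ≤ m ^ 2 + k := (Nat.pow_le_pow_iff_left two_ne_zero).1 h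
        have hk : k < n := hk
        have : l < m + 1 := lt_of_pow_lt_pow_left₀ 2 (Nat.zero_le _) (by nlinarith)
        exact Nat.pow_le_pow_left (Nat.pow_le_pow_left (Nat.lt_succ_iff.1 this) 2) 2

section definability

variable {Γ : Type} [Ctx Γ] {B C R W X Y Z T : Γ → Set ℕ}

theorem DefSet.empty : DefSet fun _ : Γ => (∅ : Set ℕ) := by
  simpa [DefSet] using (DefPos.snd.ne (DefPos.snd (Γ := Γ)))

theorem DefSet.union (hX : DefSet X) (hY : DefSet Y) : DefSet fun γ => X γ ∪ Y γ :=
  Definable.or hX hY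

theorem DefSet.isNum (hB : DefSet B) (hC : DefSet C) (hX : DefSet X) :
    Definable fun γ => IsNum (B γ) (C γ) (X γ) :=
  (hX.subset hC).and ((hB.blockBounded hX).and (hB.dominated hC hX hX))

theorem DefSet.sameNum (hB : DefSet B) (hC : DefSet C) (hX : DefSet X) (hY : DefSet Y) :
    Definable fun γ => SameNum (B γ) (C γ) (X γ) (Y γ) :=
  (hB.isNum hC hX).and ((hB.dominated hC hX hY).and (hB.dominated hC hY hX))

theorem DefSet.addRel (hB : DefSet B) (hC : DefSet C) (hX : DefSet X) (hY : DefSet Y)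
    (hZ : DefSet Z) : Definable fun γ => AddRel (B γ) (C γ) (X γ) (Y γ) (Z γ) :=
  .exSet <| (hB.wkS.sameNum hC.wkS DefSet.snd hX.wkS).and <|
  .exSet <| (hB.wkS.wkS.sameNum hC.wkS.wkS DefSet.snd hY.wkS.wkS).and <|
  (DefSet.snd.wkS.allMem (DefPos.snd.mem DefSet.snd.wkN).not).and <|
  hB.wkS.wkS.sameNum hC.wkS.wkS (DefSet.snd.wkS.union DefSet.snd) hZ.wkS.wkS

theorem DefSet.rows (hB : DefSet B) (hR : DefSet R) (hW : DefSet W) (hT : DefSet T) :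
    DefSet fun γ => rows (B γ) (R γ) (W γ) (T γ) :=
  Definable.and hW <| hT.wkN.exMem <|
    (DefPos.snd.sameBlock hB.wkN.wkN DefPos.snd.wkN).and <|
    (DefPos.snd.le DefPos.snd.wkN).and <|
    hR.wkN.wkN.allMem <| (DefPos.snd.le DefPos.snd.wkN.wkN).imp <|
    DefPos.snd.le DefPos.snd.wkN

theorem DefSet.mulRel (hB : DefSet B) (hC : DefSet C) (hX : DefSet X) (hY : DefSet Y)
    (hZ : DefSet Z) : Definable fun γ => MulRel (B γ) (C γ) (X γ) (Y γ) (Z γ) :=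
  .exSet <| (hB.wkS.sameNum hC.wkS DefSet.snd hX.wkS).and <|
  .exSet <| (hB.wkS.wkS.sameNum hC.wkS.wkS DefSet.snd hZ.wkS.wkS).and <|
  (DefSet.snd.subset (hB.wkS.wkS.rows DefSet.snd.wkS DefSet.snd DefSet.snd.wkS)).and <|
  DefSet.snd.wkS.allSubset <| (hB.wkS.wkS.wkS.isNum hC.wkS.wkS.wkS DefSet.snd).imp <|
  (hB.wkS.wkS.wkS.onePerBlock DefSet.snd).imp <|
  (hB.wkS.wkS.wkS.dominated hC.wkS.wkS.wkS DefSet.snd DefSet.empty).not.imp <|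
  hB.wkS.wkS.wkS.sameNum hC.wkS.wkS.wkS
    (hB.wkS.wkS.wkS.rows DefSet.snd.wkS.wkS DefSet.snd.wkS DefSet.snd) hY.wkS.wkS.wkS

end definability

end MSOU

/-! ### Arithmetic and partial recursive functions inside MSO+U -/

namespace MSOU

open Set Function Filter

/-- A context whose environments are presented by coordinates that are natural numbers. -/
class NumCtx (Γ : Type) where
  I : Type
  val : I → Γ → ℕ

instance : NumCtx Unit where
  I := Empty
  val i := i.elim

variable {Γ Δ : Type} [NumCtx Γ] [NumCtx Δ]

instance : NumCtx (Γ × ℕ) where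
  I := Option (NumCtx.I Γ)
  val i p := i.elim p.2 fun j => NumCtx.val j p.1

/-- `Q` is definable in MSO+U if numbers are represented by sets in the sense of `Rep`. -/
def ArithDef (Q : Γ → Prop) : Prop :=
  ∀ (Δ : Type) [Ctx Δ] (B C : Δ → Set ℕ) (X : NumCtx.I Γ → Δ → Set ℕ),
    DefSet B → DefSet C → (∀ i, DefSet (X i)) → ∃ R : Δ → Prop, Definable R ∧
      ∀ δ γ, Good (B δ) (C δ) → (∀ i, Rep (B δ) (C δ) (X i δ) (NumCtx.val i γ)) → (R δ ↔ Q γ)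

namespace ArithDef

theorem comp {Q : Γ → Prop} (hQ : ArithDef Q) (h : Δ → Γ)
    (hv : ∀ i : NumCtx.I Γ, ∃ j : NumCtx.I Δ, ∀ δ, NumCtx.val j δ = NumCtx.val i (h δ)) :
    ArithDef fun δ => Q (h δ) := by
  choose f hf using hv
  intro _ _ B C X hB hC hX
  obtain ⟨R, hR, hRQ⟩ := hQ _ B C (fun i => X (f i)) hB hC fun i => hX _
  exact ⟨R, hR, fun δ γ hg hr => hRQ δ (h γ) hg fun i => hf i γ ▸ hr (f i)⟩

theorem congr {Q R : Γ → Prop} (hQ : ArithDef Q) (h : ∀ γ, R γ ↔ Q γ) : ArithDef R := by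
  rwa [show R = Q from funext fun γ => propext (h γ)]

theorem not {Q : Γ → Prop} (hQ : ArithDef Q) : ArithDef fun γ => ¬ Q γ := by
  intro _ _ B C X hB hC hX
  obtain ⟨R, hR, h⟩ := hQ _ B C X hB hC hX
  exact ⟨_, hR.not, fun δ γ hg hr => not_congr (h δ γ hg hr)⟩

theorem and {Q Q' : Γ → Prop} (hQ : ArithDef Q) (hQ' : ArithDef Q') :
    ArithDef fun γ => Q γ ∧ Q' γ := by
  intro _ _ B C X hB hC hX
  obtain ⟨R, hR, h⟩ := hQ _ B C X hB hC hX
  obtain ⟨R', hR', h'⟩ := hQ' _ B C X hB hC hX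
  exact ⟨_, hR.and hR', fun δ γ hg hr => and_congr (h δ γ hg hr) (h' δ γ hg hr)⟩

/-- A number quantifier becomes a set quantifier relativised to `IsNum`. This is sound because every
number has a representing set and Q depends only on the number represented. -/
theorem ex {Q : Γ → ℕ → Prop} (hQ : ArithDef fun p : Γ × ℕ => Q p.1 p.2) :
    ArithDef fun γ => ∃ n, Q γ n := by
  intro Δ _ B C X hB hC hX
  obtain ⟨R, hR, h⟩ := hQ (Δ × Set ℕ) (fun p => B p.1) (fun p => C p.1)
    (fun i p => i.elim p.2 fun j => X j p.1) hB.wkS hC.wkS (by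
      rintro (_ | i)
      exacts [DefSet.snd, (hX i).wkS])
  refine ⟨_, Definable.exSet (Q := fun δ S => IsNum (B δ) (C δ) S ∧ R (δ, S))
    ((hB.wkS.isNum hC.wkS DefSet.snd).and hR), fun δ γ hg hr => ?_⟩
  have key : ∀ S n, Rep (B δ) (C δ) S n → (R (δ, S) ↔ Q γ n) := fun S n hS =>
    h (δ, S) (γ, n) hg (by
      rintro (_ | i)
      exacts [hS, hr i])
  constructor
  · rintro ⟨S, hS, hRS⟩
    obtain ⟨n, hn⟩ := (isNum_iff hg).1 hS
    exact ⟨n, (key S n hn).1 hRS⟩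
  · rintro ⟨n, hn⟩
    obtain ⟨S, hS⟩ := hg.exists_rep n
    exact ⟨S, (isNum_iff hg).2 ⟨n, hS⟩, (key S n hS).2 hn⟩

theorem imp {Q R : Γ → Prop} (hQ : ArithDef Q) (hR : ArithDef R) :
    ArithDef fun γ => Q γ → R γ :=
  (hQ.and hR.not).not.congr fun γ => by tauto

theorem or {Q R : Γ → Prop} (hQ : ArithDef Q) (hR : ArithDef R) :
    ArithDef fun γ => Q γ ∨ R γ :=
  (hQ.not.and hR.not).not.congr fun γ => by tauto

theorem all {Q : Γ → ℕ → Prop} (hQ : ArithDef fun p : Γ × ℕ => Q p.1 p.2) :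
    ArithDef fun γ => ∀ n, Q γ n :=
  (ex (Q := fun γ n => ¬ Q γ n) hQ.not).not.congr fun γ => by simp

end ArithDef

/-- A number-valued term, given by its definable graph. -/
def ArithTerm (t : Γ → ℕ) : Prop := ArithDef fun p : Γ × ℕ => t p.1 = p.2

theorem ArithTerm.snd : ArithTerm fun p : Γ × ℕ => p.2 := fun _ _ _ _ X hB hC hX =>
  ⟨_, hB.sameNum hC (hX (some none)) (hX none), fun δ γ hg hr => by
    rw [(hr none).sameNum_iff hg]
    exact ⟨fun h => (hr (some none)).unique h, fun h =>
      Eq.subst (motive := fun n => Rep _ _ (X (some none) δ) n) (show γ.1.2 = γ.2 from h)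
        (hr (some none))⟩⟩

theorem ArithTerm.wk {t : Γ → ℕ} (ht : ArithTerm t) : ArithTerm fun p : Γ × ℕ => t p.1 :=
  ht.comp (fun p : (Γ × ℕ) × ℕ => (p.1.1, p.2)) (by
    rintro (_ | i)
    exacts [⟨none, fun _ => rfl⟩, ⟨some (some i), fun _ => rfl⟩])

variable {s t u : Γ → ℕ}

theorem ArithTerm.eq (hs : ArithTerm s) (ht : ArithTerm t) : ArithDef fun γ => s γ = t γ :=
  (ArithDef.ex (Q := fun γ n => s γ = n ∧ t γ = n) (ArithDef.and hs ht)).congr fun γ => by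
    simp [eq_comm]

theorem ArithDef.app₂ {R : ℕ → ℕ → Prop} (hR : ArithDef fun p : (Unit × ℕ) × ℕ => R p.1.2 p.2)
    (hs : ArithTerm s) (ht : ArithTerm t) : ArithDef fun γ => R (s γ) (t γ) :=
  (ArithDef.ex (Q := fun γ a => ∃ b, (s γ = a ∧ t γ = b) ∧ R a b) <| ArithDef.ex <|
    ((hs.wk.wk.eq ArithTerm.snd.wk).and (ht.wk.wk.eq ArithTerm.snd)).and <|
    hR.comp (fun p : (Γ × ℕ) × ℕ => (((), p.1.2), p.2)) (by
      rintro (_ | _ | i)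
      exacts [⟨none, fun _ => rfl⟩, ⟨some none, fun _ => rfl⟩, i.elim])).congr fun γ => by simp

theorem ArithDef.mem_app {f : ℕ →. ℕ} (hf : ArithDef fun p : (Unit × ℕ) × ℕ => p.2 ∈ f p.1.2)
    (hs : ArithTerm s) (ht : ArithTerm t) : ArithDef fun γ => t γ ∈ f (s γ) :=
  ArithDef.app₂ (R := fun a b => b ∈ f a) hf hs ht

theorem ArithDef.app₃ {R : ℕ → ℕ → ℕ → Prop}
    (hR : ArithDef fun p : ((Unit × ℕ) × ℕ) × ℕ => R p.1.1.2 p.1.2 p.2)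
    (hs : ArithTerm s) (ht : ArithTerm t) (hu : ArithTerm u) :
    ArithDef fun γ => R (s γ) (t γ) (u γ) :=
  (ArithDef.ex (Q := fun γ a => ∃ b c, ((s γ = a ∧ t γ = b) ∧ u γ = c) ∧ R a b c) <|
    ArithDef.ex <| ArithDef.ex <|
    (((hs.wk.wk.wk.eq ArithTerm.snd.wk.wk).and (ht.wk.wk.wk.eq ArithTerm.snd.wk)).and
      (hu.wk.wk.wk.eq ArithTerm.snd)).and <|
    hR.comp (fun p : ((Γ × ℕ) × ℕ) × ℕ => ((((), p.1.1.2), p.1.2), p.2)) (by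
      rintro (_ | _ | _ | i)
      exacts [⟨none, fun _ => rfl⟩, ⟨some none, fun _ => rfl⟩, ⟨some (some none), fun _ => rfl⟩,
        i.elim])).congr fun γ => by simp

namespace ArithTerm

theorem add (hs : ArithTerm s) (ht : ArithTerm t) : ArithTerm fun γ => s γ + t γ :=
  ArithDef.app₃ (R := fun a b c => a + b = c) (fun _ _ _ _ _ hB hC hX =>
    ⟨_, hB.addRel hC (hX (some (some none))) (hX (some none)) (hX none), fun _ _ hg hr =>
      addRel_iff hg (hr (some (some none))) (hr (some none)) (hr none)⟩) hs.wk ht.wk snd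

theorem mul (hs : ArithTerm s) (ht : ArithTerm t) : ArithTerm fun γ => s γ * t γ :=
  ArithDef.app₃ (R := fun a b c => a * b = c) (fun _ _ _ _ _ hB hC hX =>
    ⟨_, hB.mulRel hC (hX (some (some none))) (hX (some none)) (hX none), fun _ _ hg hr =>
      mulRel_iff hg (hr (some (some none))) (hr (some none)) (hr none)⟩) hs.wk ht.wk snd

/-- Zero is the only solution of n + n = n; likewise one is the only nonzero solution of n · n = n.
-/
theorem zero : ArithTerm fun _ : Γ => 0 :=
  ((snd.add snd).eq snd).congr fun p => by dsimp only; omega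

theorem one : ArithTerm fun _ : Γ => 1 :=
  (((snd.mul snd).eq snd).and (snd.eq zero).not).congr fun p => by
    constructor
    · rintro h
      simp [← h]
    · rintro ⟨h, h0⟩
      exact (Nat.eq_of_mul_eq_mul_left (Nat.pos_of_ne_zero h0) (by rw [h, mul_one])).symm

theorem succ (hs : ArithTerm s) : ArithTerm fun γ => s γ + 1 := hs.add one

theorem lt (hs : ArithTerm s) (ht : ArithTerm t) : ArithDef fun γ => s γ < t γ :=
  (ArithDef.ex (Q := fun γ k => s γ + 1 + k = t γ) ((hs.succ.wk.add snd).eq ht.wk)).congr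
    fun γ => ⟨fun h => ⟨_, Nat.add_sub_of_le h⟩, fun ⟨k, hk⟩ => by omega⟩

theorem pair (hs : ArithTerm s) (ht : ArithTerm t) : ArithTerm fun γ => Nat.pair (s γ) (t γ) :=
  (((hs.wk.lt ht.wk).and (((ht.mul ht).add hs).wk.eq snd)).or
    ((hs.wk.lt ht.wk).not.and ((((hs.mul hs).add hs).add ht).wk.eq snd))).congr fun p => by
    dsimp only
    rw [Nat.pair]
    split_ifs with h <;> simp [h]

theorem unpair_fst (hs : ArithTerm s) : ArithTerm fun γ => (Nat.unpair (s γ)).1 :=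
  (ArithDef.ex (Q := fun (p : Γ × ℕ) c => Nat.pair p.2 c = s p.1)
    ((snd.wk.pair snd).eq hs.wk.wk)).congr fun p => by
    constructor
    · rintro h
      exact ⟨(Nat.unpair (s p.1)).2, by rw [← h, Nat.pair_unpair]⟩
    · rintro ⟨c, h⟩
      dsimp only
      rw [← h, Nat.unpair_pair]

theorem unpair_snd (hs : ArithTerm s) : ArithTerm fun γ => (Nat.unpair (s γ)).2 :=
  (ArithDef.ex (Q := fun (p : Γ × ℕ) c => Nat.pair c p.2 = s p.1)
    ((snd.pair snd.wk).eq hs.wk.wk)).congr fun p => by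
    constructor
    · rintro h
      exact ⟨(Nat.unpair (s p.1)).1, by rw [← h, Nat.pair_unpair]⟩
    · rintro ⟨c, h⟩
      dsimp only
      rw [← h, Nat.unpair_pair]

theorem mod_succ (hs : ArithTerm s) (ht : ArithTerm t) : ArithTerm fun γ => s γ % (t γ + 1) :=
  ((snd.lt ht.succ.wk).and (ArithDef.ex (Q := fun (p : Γ × ℕ) q => p.2 + (t p.1 + 1) * q = s p.1)
    ((snd.wk.add (ht.succ.wk.wk.mul snd)).eq hs.wk.wk))).congr fun p => by
    constructor
    · rintro h
      rw [← h]
      exact ⟨Nat.mod_lt _ (Nat.succ_pos _), _, Nat.mod_add_div _ _⟩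
    · rintro ⟨h, q, hq⟩
      dsimp only
      rw [← hq, Nat.add_mul_mod_self_left, Nat.mod_eq_of_lt h]

theorem beta (hs : ArithTerm s) (ht : ArithTerm t) : ArithTerm fun γ => Nat.beta (s γ) (t γ) :=
  hs.unpair_fst.mod_succ (ht.succ.mul hs.unpair_snd)

end ArithTerm

/-- Gödel's β function codes the sequence of intermediate values of the recursion by the single
number c, so that the recursion becomes a first-order statement. -/
theorem mem_rec_iff_exists_beta {f : ℕ →. ℕ} {g : ℕ →. ℕ} {a n b : ℕ} :
    b ∈ (n.rec (f a) fun y IH => do let i ← IH; g (Nat.pair a (Nat.pair y i)) : Part ℕ) ↔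
      ∃ c, Nat.beta c 0 ∈ f a ∧ (∀ k, k < n → Nat.beta c (k + 1) ∈
        g (Nat.pair a (Nat.pair k (Nat.beta c k)))) ∧ Nat.beta c n = b := by
  constructor
  · intro h
    have : ∃ e : ℕ → ℕ, e 0 ∈ f a ∧ (∀ k, k < n → e (k + 1) ∈
        g (Nat.pair a (Nat.pair k (e k)))) ∧ e n = b := by
      induction n generalizing b with
      | zero => exact ⟨fun _ => b, h, by simp, rfl⟩
      | succ n ih =>
        obtain ⟨i, hi, hb⟩ := Part.mem_bind_iff.1 h
        obtain ⟨e, h0, hk, hn⟩ := ih hi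
        refine ⟨update e (n + 1) b, by simpa using h0, fun k hkn => ?_, by simp⟩
        rw [update_of_ne (a := k) (by omega)]
        rcases Nat.lt_succ_iff_lt_or_eq.1 hkn with hlt | rfl
        · rw [update_of_ne (by omega)]
          exact hk k hlt
        · rw [update_self, hn]
          exact hb
    obtain ⟨e, h0, hk, hn⟩ := this
    have hbeta : ∀ k ≤ n, Nat.beta (Nat.unbeta ((List.range (n + 1)).map e)) k = e k := by
      intro k hk
      have := Nat.beta_unbeta_coe ((List.range (n + 1)).map e) ⟨k, by simp; omega⟩
      simpa using this
    refine ⟨_, (hbeta 0 (Nat.zero_le _)).symm ▸ h0, fun k hkn => ?_, (hbeta n le_rfl).trans hn⟩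
    rw [hbeta _ hkn, hbeta _ hkn.le]
    exact hk k hkn
  · rintro ⟨c, h0, hk, rfl⟩
    have : ∀ k ≤ n, Nat.beta c k ∈ (k.rec (f a) fun y IH => do
        let i ← IH; g (Nat.pair a (Nat.pair y i)) : Part ℕ) := by
      intro k hkn
      induction k with
      | zero => exact h0
      | succ k ih => exact Part.mem_bind_iff.2 ⟨_, ih (by omega), hk k hkn⟩
    exact this n le_rfl

/-- Induction on the construction of f: compositions and pairings quantify over intermediate values,
recursion uses β, and minimisation asks for a zero all of whose predecessors have defined, nonzero
values. -/
theorem arithDef_of_partrec {f : ℕ →. ℕ} (hf : Nat.Partrec f) :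
    ArithDef fun p : (Unit × ℕ) × ℕ => p.2 ∈ f p.1.2 := by
  have hx : ArithTerm fun p : (Unit × ℕ) × ℕ => p.1.2 := ArithTerm.snd.wk
  have hy : ArithTerm fun p : (Unit × ℕ) × ℕ => p.2 := ArithTerm.snd
  induction hf with
  | zero => exact (hy.eq .zero).congr fun p => Part.mem_some_iff
  | succ => exact (hy.eq hx.succ).congr fun p => Part.mem_some_iff
  | left => exact (hy.eq hx.unpair_fst).congr fun p => Part.mem_some_iff
  | right => exact (hy.eq hx.unpair_snd).congr fun p => Part.mem_some_iff
  | @pair f g _ _ hf hg =>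
    refine (ArithDef.ex (Q := fun (p : (Unit × ℕ) × ℕ) b => ∃ c, b ∈ f p.1.2 ∧ c ∈ g p.1.2 ∧
      p.2 = Nat.pair b c) <| ArithDef.ex <| (hf.mem_app hx.wk.wk ArithTerm.snd.wk).and <|
      (hg.mem_app hx.wk.wk ArithTerm.snd).and <| hy.wk.wk.eq (ArithTerm.snd.wk.pair .snd)).congr
      fun p => ?_
    simp [Seq.seq, Part.mem_bind_iff, eq_comm]
  | @comp f g _ _ hf hg =>
    exact (ArithDef.ex (Q := fun (p : (Unit × ℕ) × ℕ) b => b ∈ g p.1.2 ∧ p.2 ∈ f b) <|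
      (hg.mem_app hx.wk ArithTerm.snd).and (hf.mem_app ArithTerm.snd hy.wk)).congr
      fun p => Part.mem_bind_iff
  | @prec f g _ _ hf hg =>
    refine (ArithDef.ex (Q := fun (p : (Unit × ℕ) × ℕ) c => Nat.beta c 0 ∈ f p.1.2.unpair.1 ∧
      (∀ k, k < p.1.2.unpair.2 → Nat.beta c (k + 1) ∈
        g (Nat.pair p.1.2.unpair.1 (Nat.pair k (Nat.beta c k)))) ∧
      Nat.beta c p.1.2.unpair.2 = p.2) <|
      (hf.mem_app hx.unpair_fst.wk (ArithTerm.snd.beta .zero)).and <|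
      (ArithDef.all <| (ArithTerm.snd.lt hx.unpair_snd.wk.wk).imp <|
        hg.mem_app (hx.unpair_fst.wk.wk.pair (ArithTerm.snd.pair (ArithTerm.snd.wk.beta .snd)))
          (ArithTerm.snd.wk.beta ArithTerm.snd.succ)).and <|
      (ArithTerm.snd.beta hx.unpair_snd.wk).eq hy.wk).congr fun p => ?_
    exact mem_rec_iff_exists_beta
  | @rfind f _ hf =>
    refine ((hf.mem_app (hx.pair hy) .zero).and <| ArithDef.all
      (Q := fun (p : (Unit × ℕ) × ℕ) m => m < p.2 → ∃ c, c ≠ 0 ∧ c ∈ f (Nat.pair p.1.2 m)) <|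
      (ArithTerm.snd.lt hy.wk).imp <| ArithDef.ex <| (ArithTerm.snd.eq .zero).not.and <|
      hf.mem_app (hx.wk.wk.pair ArithTerm.snd.wk) .snd).congr fun p => ?_
    refine Nat.mem_rfind.trans ?_
    simp [and_comm]

end MSOU

/-! ### Reduction from the halting problem -/

namespace MSOU

open Set Function Filter

/-- Three set variables. -/
abbrev SetCtx₃ := ((Unit × Set ℕ) × Set ℕ) × Set ℕ

/-- Instances of `Definable` on three set variables, with the names `0`, `1`, `2`. -/
theorem Definable.exists_formula₃ {Q : Set ℕ → Set ℕ → Set ℕ → Prop}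
    (hQ : Definable fun p : SetCtx₃ => Q p.1.1.2 p.1.2 p.2) (A : Type) :
    ∃ φ : Formula A, φ.freePos = ∅ ∧ φ.freeSet ⊆ {0, 1, 2} ∧
      ∀ P v V, φ.Sat P v V ↔ Q (V 0) (V 1) (V 2) := by
  obtain ⟨φ, h1, h2, h3⟩ := hQ A (fun i => Empty.elim i)
    (fun i => i.elim 2 fun j => j.elim 1 fun k => k.elim 0 Empty.elim)
  refine ⟨φ, ?_, fun n hn => ?_, fun P v V => h3 P v V ((((), V 0), V 1), V 2) ?_ ?_⟩
  · refine Finset.eq_empty_of_forall_notMem fun n hn => ?_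
    obtain ⟨i, -⟩ := h1 n hn
    exact Empty.elim i
  · obtain ⟨_ | _ | _ | i, rfl⟩ := h2 n hn
    exacts [by simp, by simp, by simp, Empty.elim i]
  · exact fun i => Empty.elim i
  · rintro (_ | _ | _ | i)
    exacts [rfl, rfl, rfl, Empty.elim i]

/-- Instances of `Definable` on four set variables, with the names `0`, `1`, `2`, `3`. -/
theorem Definable.exists_formula₄ {Q : Set ℕ → Set ℕ → Set ℕ → Set ℕ → Prop}
    (hQ : Definable fun p : SetCtx₃ × Set ℕ => Q p.1.1.1.2 p.1.1.2 p.1.2 p.2) (A : Type) :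
    ∃ φ : Formula A, φ.freePos = ∅ ∧ φ.freeSet ⊆ {0, 1, 2, 3} ∧
      ∀ P v V, φ.Sat P v V ↔ Q (V 0) (V 1) (V 2) (V 3) := by
  obtain ⟨φ, h1, h2, h3⟩ := hQ A (fun i => Empty.elim i)
    (fun i => i.elim 3 fun i => i.elim 2 fun j => j.elim 1 fun k => k.elim 0 Empty.elim)
  refine ⟨φ, ?_, fun n hn => ?_, fun P v V => h3 P v V (((((), V 0), V 1), V 2), V 3) ?_ ?_⟩
  · refine Finset.eq_empty_of_forall_notMem fun n hn => ?_
    obtain ⟨i, -⟩ := h1 n hn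
    exact Empty.elim i
  · obtain ⟨_ | _ | _ | _ | i, rfl⟩ := h2 n hn
    exacts [by simp, by simp, by simp, by simp, Empty.elim i]
  · exact fun i => Empty.elim i
  · rintro (_ | _ | _ | _ | i)
    exacts [rfl, rfl, rfl, rfl, Empty.elim i]

/-- Given a formula `succF` for "`3` represents the successor of what `2` represents" and a formula
`eqF` for "`2` and `3` are equal", this says that `χ` holds for the successor of `2`. -/
def Formula.shift {A : Type} (succF eqF χ : Formula A) : Formula A :=
  .exSet 3 (.and succF (.exSet 2 (.and eqF χ)))

/-- The numeral k is expressed by k nested passages to a successor. Copying the successor from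
variable 3 back to variable 2 reuses the names, so each passage is the same operation on formulas.
-/
theorem Formula.sat_iterate_shift {A : Type} {succF eqF θ : Formula A} {D : ℕ → Prop}
    {P : A → Set ℕ} (hs : ∀ v V n, Good (V 0) (V 1) → Rep (V 0) (V 1) (V 2) n →
      (succF.Sat P v V ↔ Rep (V 0) (V 1) (V 3) (n + 1)))
    (he : ∀ v V, eqF.Sat P v V ↔ V 2 = V 3)
    (hθ : ∀ v V n, Good (V 0) (V 1) → Rep (V 0) (V 1) (V 2) n → (θ.Sat P v V ↔ D n)) (k : ℕ) :
    ∀ v V n, Good (V 0) (V 1) → Rep (V 0) (V 1) (V 2) n →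
      (((shift succF eqF)^[k] θ).Sat P v V ↔ D (n + k)) := by
  induction k with
  | zero => exact hθ
  | succ k ih =>
    intro v V n hg hr
    rw [iterate_succ_apply']
    simp only [shift, Sat, he]
    have key : ∀ S, succF.Sat P v (update V 3 S) ↔ Rep (V 0) (V 1) S (n + 1) := fun S =>
      hs v (update V 3 S) n hg hr
    simp only [key]
    have key₂ : ∀ S, Rep (V 0) (V 1) S (n + 1) → ((((shift succF eqF)^[k] θ).Sat P v
        (update (update V 3 S) 2 S)) ↔ D (n + 1 + k)) := fun S hS =>
      ih v (update (update V 3 S) 2 S) (n + 1) hg hS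
    rw [show n + (k + 1) = n + 1 + k by omega]
    constructor
    · rintro ⟨S, hS, T, hTS, hT⟩
      obtain rfl : T = S := hTS
      exact (key₂ T hS).1 hT
    · intro h
      obtain ⟨S, hS⟩ := hg.exists_rep (n + 1)
      exact ⟨S, hS, S, rfl, (key₂ S hS).2 h⟩

/-- The sentence which says that in some good partition into blocks and cells `χ` holds for a set
which satisfies `zeroF`. -/
def Formula.closeGood {A : Type} (goodF zeroF χ : Formula A) : Formula A :=
  .exSet 0 (.exSet 1 (.exSet 2 (.and (.and goodF zeroF) χ)))

theorem exists_sentences {f : ℕ →. ℕ} (hf : Nat.Partrec f) (A : Type) :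
    ∃ goodF zeroF succF eqF θ : Formula A, ∀ k,
      (Formula.closeGood goodF zeroF ((Formula.shift succF eqF)^[k] θ)).IsSentence ∧
      ∀ P v V, (Formula.closeGood goodF zeroF ((Formula.shift succF eqF)^[k] θ)).Sat P v V ↔
        (f k).Dom := by
  have hB : DefSet fun p : SetCtx₃ => p.1.1.2 := DefSet.snd.wkS.wkS
  have hC : DefSet fun p : SetCtx₃ => p.1.2 := DefSet.snd.wkS
  have hX : DefSet fun p : SetCtx₃ => p.2 := DefSet.snd
  obtain ⟨goodF, g1, g2, g3⟩ := (hB.good hC).exists_formula₃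
    (Q := fun B C _ => Good B C) A
  obtain ⟨zeroF, z1, z2, z3⟩ := (hB.sameNum hC hX DefSet.empty).exists_formula₃
    (Q := fun B C X => SameNum B C X ∅) A
  obtain ⟨eqF, e1, e2, e3⟩ := ((hX.wkS.subset DefSet.snd).and
    (DefSet.snd.subset hX.wkS)).exists_formula₄ (Q := fun _ _ X Y => X ⊆ Y ∧ Y ⊆ X) A
  obtain ⟨R, hR, hR'⟩ := (ArithTerm.snd.wk.succ.eq ArithTerm.snd : ArithDef
    fun p : (Unit × ℕ) × ℕ => p.1.2 + 1 = p.2) _ _ _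
    (fun i => i.elim (fun p : SetCtx₃ × Set ℕ => p.2) fun j => j.elim (fun p => p.1.2) Empty.elim)
    hB.wkS hC.wkS (by
      rintro (_ | _ | i)
      exacts [DefSet.snd, hX.wkS, Empty.elim i])
  -- The conjunct `IsNum` is needed because R is meaningful only for sets that represent numbers.
  obtain ⟨succF, s1, s2, s3⟩ := ((hB.wkS.isNum hC.wkS DefSet.snd).and hR).exists_formula₄
    (Q := fun B C X Y => IsNum B C Y ∧ R (((((), B), C), X), Y)) A
  obtain ⟨T, hT, hT'⟩ := (ArithDef.ex (Q := fun (p : Unit × ℕ) b => b ∈ f p.2)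
    (arithDef_of_partrec hf)) _ _ _
    (fun i => i.elim (fun p : SetCtx₃ => p.2) Empty.elim) hB hC (by
      rintro (_ | i)
      exacts [hX, Empty.elim i])
  obtain ⟨θ, t1, t2, t3⟩ := hT.exists_formula₃ (Q := fun B C X => T ((((), B), C), X)) A
  refine ⟨goodF, zeroF, succF, eqF, θ, fun k => ⟨?_, fun P v V => ?_⟩⟩
  · have hk : ((Formula.shift succF eqF)^[k] θ).freePos = ∅ ∧
        ((Formula.shift succF eqF)^[k] θ).freeSet ⊆ {0, 1, 2} := by
      induction k with
      | zero => exact ⟨t1, t2⟩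
      | succ k ih =>
        rw [iterate_succ_apply']
        refine ⟨by simp [Formula.shift, Formula.freePos, s1, e1, ih.1], fun n hn => ?_⟩
        simp only [Formula.shift, Formula.freeSet, Finset.mem_erase, Finset.mem_union] at hn
        have hs := @s2 n
        have he := @e2 n
        have hi := @ih.2 n
        simp only [Finset.mem_insert, Finset.mem_singleton] at hs he hi ⊢
        grind
    refine ⟨by simp [Formula.closeGood, Formula.freePos, g1, z1, hk.1],
      Finset.eq_empty_of_forall_notMem fun n hn => ?_⟩
    simp only [Formula.closeGood, Formula.freeSet, Finset.mem_erase, Finset.mem_union] at hn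
    have hg := @g2 n
    have hz := @z2 n
    have hi := @hk.2 n
    simp only [Finset.mem_insert, Finset.mem_singleton] at hg hz hi
    grind
  · have hiter := Formula.sat_iterate_shift (P := P) (succF := succF) (eqF := eqF) (θ := θ)
      (D := fun k => ∃ b, b ∈ f k) (fun v V n hg hr => by
        rw [s3]
        constructor
        · rintro ⟨hY, hRY⟩
          obtain ⟨m, hm⟩ := (isNum_iff hg).1 hY
          have := (hR' (((((), V 0), V 1), V 2), V 3) (((), n), m) hg (by
            rintro (_ | _ | i)
            exacts [hm, hr, Empty.elim i])).1 hRY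
          exact (show n + 1 = m from this) ▸ hm
        · intro hm
          exact ⟨(isNum_iff hg).2 ⟨_, hm⟩,
            (hR' (((((), V 0), V 1), V 2), V 3) (((), n), n + 1) hg (by
            rintro (_ | _ | i)
            exacts [hm, hr, Empty.elim i])).2 rfl⟩)
      (fun v V => by rw [e3, Subset.antisymm_iff])
      (fun v V n hg hr => by
        rw [t3]
        exact hT' ((((), V 0), V 1), V 2) ((), n) hg (by
          rintro (_ | i)
          exacts [hr, Empty.elim i])) k
    rw [Part.dom_iff_mem]
    simp only [Formula.closeGood, Formula.Sat, g3, z3]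
    constructor
    · rintro ⟨B, C, X, ⟨hg, hz⟩, hχ⟩
      have := (hiter _ _ 0 hg (((Rep.empty _ _).sameNum_iff hg).1 hz)).1 hχ
      rwa [Nat.zero_add] at this
    · intro h
      obtain ⟨B, C, hg⟩ := exists_good
      refine ⟨B, C, ∅, ⟨hg, ((Rep.empty _ _).sameNum_iff hg).2 (Rep.empty _ _)⟩, ?_⟩
      exact (hiter _ (update (update (update V 0 B) 1 C) 2 ∅) 0 hg (Rep.empty _ _)).2
        (by rwa [Nat.zero_add])

/-- The five formulas are constants, and one shift acts on codes by a fixed primitive recursive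
function, which is iterated k times. -/
theorem computable_code_closeGood {A : Type} [Encodable A] (goodF zeroF succF eqF θ : Formula A) :
    Computable fun k : ℕ =>
      (Formula.closeGood goodF zeroF ((Formula.shift succF eqF)^[k] θ)).code := by
  have hp : ∀ (c : ℕ) {g : ℕ → ℕ}, Primrec g → Primrec fun r => Nat.pair c (g r) :=
    fun c _ hg => Primrec₂.natPair.comp (.const c) hg
  have hstep : Primrec fun r : ℕ => Nat.pair 7 (Nat.pair 3 (Nat.pair 5 (Nat.pair succF.code
      (Nat.pair 7 (Nat.pair 2 (Nat.pair 5 (Nat.pair eqF.code r))))))) :=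
    hp _ (hp _ (hp _ (hp _ (hp _ (hp _ (hp _ (hp _ .id)))))))
  have hiter : ∀ k, ((Formula.shift succF eqF)^[k] θ).code =
      (fun r : ℕ => Nat.pair 7 (Nat.pair 3 (Nat.pair 5 (Nat.pair succF.code
      (Nat.pair 7 (Nat.pair 2 (Nat.pair 5 (Nat.pair eqF.code r))))))))^[k] θ.code := by
    intro k
    induction k with
    | zero => rfl
    | succ k ih => rw [iterate_succ_apply', iterate_succ_apply', ← ih]; rfl
  have hcode : Primrec fun k : ℕ => ((Formula.shift succF eqF)^[k] θ).code :=
    (Primrec.nat_iterate .id (.const θ.code) (hstep.comp .snd).to₂).of_eq fun k => (hiter k).symm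
  exact (hp 7 (hp 0 (hp 7 (hp 1 (hp 7 (hp 2 (hp 5 (hp (Formula.and goodF zeroF).code
    hcode)))))))).to_comp

/-- A set of sentences is undecidable if it contains, of all sentences whose truth depends neither
on the letters nor on the values of the variables, exactly the true ones. -/
theorem not_isDecidable_of_mem_iff {A : Type} [Encodable A] {T : Set (Formula A)}
    (hT : ∀ φ : Formula A, φ.IsSentence → ∀ p : Prop, (∀ P v V, φ.Sat P v V ↔ p) → (φ ∈ T ↔ p)) :
    ¬ IsDecidable T := by
  intro hdec
  -- The function n ↦ result of the n-th program on input 0; its domain is the halting problem.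
  have hf : Nat.Partrec fun n => (Denumerable.ofNat Nat.Partrec.Code n).eval 0 :=
    Partrec.nat_iff.1 (Nat.Partrec.Code.eval_part.comp (Computable.ofNat _) (Computable.const 0))
  obtain ⟨goodF, zeroF, succF, eqF, θ, h⟩ := exists_sentences hf A
  refine ComputablePred.halting_problem 0 (ComputablePred.computable_of_manyOneReducible
    ⟨fun c => _, (computable_code_closeGood goodF zeroF succF eqF θ).comp Computable.encode,
      fun c => ?_⟩ hdec)
  have hk := h (Encodable.encode c)
  rw [Denumerable.ofNat_encode] at hk
  refine (hT _ hk.1 _ hk.2).symm.trans ?_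
  constructor
  · exact fun hmem => ⟨_, hmem, rfl⟩
  · rintro ⟨φ, hφ, hcode⟩
    rwa [← Formula.code_injective hcode]

end MSOU

theorem theorem1 :
    ¬ MSOU.IsDecidable MSOU.theoryNatLE ∧
      ∀ k : ℕ, 1 ≤ k → ¬ MSOU.IsDecidable (MSOU.satisfiableOverWords (Fin k)) := by
  constructor
  · refine MSOU.not_isDecidable_of_mem_iff fun φ hφ p hp => ?_
    constructor
    · exact fun h => (hp _ (fun _ => 0) (fun _ => ∅)).1 (h.2 _ _)
    · exact fun h => ⟨hφ, fun v V => (hp _ v V).2 h⟩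
  · refine fun k hk => MSOU.not_isDecidable_of_mem_iff fun φ hφ p hp => ?_
    constructor
    · rintro ⟨-, w, hw⟩
      exact (hp _ (fun _ => 0) (fun _ => ∅)).1 (hw _ _)
    -- Truth does not depend on the letters, so any word serves as a witness; 1 ≤ k provides the
    -- letter 0 for a constant one.
    · exact fun h => ⟨hφ, fun _ => ⟨0, hk⟩, fun v V => (hp _ v V).2 h⟩
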